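/- Let $N\ge 2$, $\omega=e^{2\pi i/N}$, and let $r\in\mathbb C$ with $\operatorname{Re} r>0$. Matrices on $\mathbb C^N\otimes\mathbb C^N$ are written $M=(M_{i_1i_2}^{j_1j_2})$ with row index $(i_1,i_2)$ and column index $(j_1,j_2)$, $1\le i_1,i_2,j_1,j_2\le N$; $M_{21}$ denotes $M$ with the two tensor factors exchanged. **Data.** Let $\Gamma_k(x|\omega_1,\dots,\omega_k)=\exp\big(\partial_s\sum_{n\in\mathbb N^k}(x+n_1\omega_1+\dots+n_k\omega_k)^{-s}\big|_{s=0}\big)$ be Barnes' multiple gamma function (the series being continued analytically in $s$) and $S_k(x|\omega_1,\dots,\omega_k)=\Gamma_k(\omega_1+\dots+\omega_k-x|\cdot)^{(-1)^k}\,\Gamma_k(x|\cdot)^{-1}$ the multiple sine function. Put $$\rho_{DY}(u)=\frac{\Gamma_1(u|N)\Gamma_1(u+N|N)}{\Gamma_1(u+1|N)\Gamma_1(u+N-1|N)},\qquad \rho_{DYr}(u)=\frac{S_2(-u|r,N)\,S_2(1+u|r,N)}{S_2(u|r,N)\,S_2(1-u|r,N)},\qquad \kappa(u)=\frac1N\,\frac{\sin\frac{\pi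 u}r\,\sin\frac\pi r}{\sin\frac{\pi(u+1)}r}.$$ The $R$-matrix of $DY(sl_N)$ is $R_{DY}(u)=\rho_{DY}(u)\,Y(u)$, where the non-zero entries of $Y(u)$ are $Y_{aa}^{aa}=1$, $Y_{ab}^{ab}=\frac u{u+1}$, $Y_{ab}^{ba}=\frac1{u+1}$ ($a\ne b$). The $R$-matrix of $DY_r(sl_N)$ is $R(u,r)=(V\otimes V)\,\overline R(u,r)\,(V\otimes V)^{-1}$ with $V_i^j=N^{-1/2}\omega^{(i-1)j}$, $\overline R(u,r)=-\rho_{DYr}(u)\,\kappa(u)\,\overline S(u,r)$, where $$\overline S_{a,b}^{c,d}(u,r)=\frac{\sin\frac{\pi}{Nr}(u+1+(b-a)r)}{\sin\frac{\pi}{Nr}(u+(b-c)r)\,\sin\frac{\pi}{Nr}(1-(a-c)r)}\quad\text{if } d\equiv a+b-c \bmod N,$$ and $\overline S_{a,b}^{c,d}=0$ otherwise. Let $S(u)=(V\otimes V)\,\overline S(u,r)\,(V\otimes V)^{-1}$. Finally let $\phi=\mathrm{diag}(\omega^{-a})_{1\le a\le N}$, and let $F(u)$ be the matrix with $F_{aa}^{aa}=1$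 and, for $a\ne b$, $$F_{ab}^{ab}(u)=b_{ab}(u)=\frac{\Gamma(\frac{u-1}r+1)}{\Gamma(\frac ur+1)}\;{}_2F_1\Big(-\tfrac1r,\tfrac{u-1}r+1;\tfrac ur+1;\omega^{b-a}\Big),$$ $$F_{ab}^{ba}(u)=c_{ab}(u)=-\frac{\omega^{b-a}}r\,\frac{\Gamma(\frac{u-1}r+1)}{\Gamma(\frac ur+2)}\;{}_2F_1\Big(1-\tfrac1r,\tfrac{u-1}r+1;\tfrac ur+2;\omega^{b-a}\Big),$$ all other entries being $0$. **Claims.** 1. If none of $u,\,u-1,\,u+1$ lies in $\{-r,-2r,-3r,\dots\}$, then $F(u)$ is invertible, $$F(u+r)=(\phi\otimes 1)^{-1}F(u)(\phi\otimes 1)\,Y(u+r),$$ and for all $a\ne b$ $$\omega^{b-a}(u+2r+1)b_{ab}(u+2r)-(u+r+\omega^{b-a}(u+2r))b_{ab}(u+r)+(u+r-1)b_{ab}(u)=0,$$ $$(u+2r+1)c_{ab}(u+2r)-(u+r+\omega^{a-b}(u+2r))c_{ab}(u+r)+\omega^{a-b}(u+r-1)c_{ab}(u)=0.$$ 2. $V$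 is invertible. If $1/r\notin\mathbb Z$ and none of $u,\,u+1,\,u-1$ lies in $r\mathbb Z$, then $R^F(u):=F_{21}(-u)\,R_{DY}(u)\,F_{12}(u)^{-1}$ satisfies $$R^F(u)=\rho_{DY}(u)\,\kappa(u)\,S(u),\qquad R(u,r)=-\rho_{DYr}(u)\,\kappa(u)\,S(u);$$ hence, up to the scalar normalisation, $R^F$ is the $R$-matrix of $DY_r(sl_N)$: $R^F(u)=-\frac{\rho_{DY}(u)}{\rho_{DYr}(u)}R(u,r)$ wherever $\rho_{DYr}(u)$ is finite and non-zero. Moreover the entries of $S$ are $$S_{aa}^{aa}=N\Big(\cot\frac{\pi u}r+\cot\frac\pi r\Big),\qquad S_{ab}^{ab}=N\,\frac{e^{i\pi/r}}{\sin\frac\pi r}\,e^{-2i\pi n/(Nr)},\qquad S_{ab}^{ba}=N\,\frac{e^{i\pi u/r}}{\sin\frac{\pi u}r}\,e^{-2i\pi nu/(Nr)}$$ for $a\neq b$, where $n\in\{1,\dots,N-1\}$ is the residue of $b-a$ modulo $N$, and all other entries of $S$ vanish. -/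

import Mathlib

open scoped Kronecker

namespace DeformedYangian

noncomputable section

/-! ### Barnes' multiple gamma and sine functions -/

/-- `Z` is the meromorphic continuation in `s` (holomorphic away from `s = 1, …, k`) of the
Barnes zeta series `∑_{n ∈ ℕ^k} (x + n₁ ω₁ + ⋯ + n_k ω_k)^{-s}`, which converges for
`Re s > k` when the periods lie in the right half plane. -/
def IsBarnesZeta {k : ℕ} (x : ℂ) (ω : Fin k → ℂ) (Z : ℂ → ℂ) : Prop :=
  DifferentiableOn ℂ Z {s : ℂ | ∀ j ∈ Finset.Icc 1 k, s ≠ (j : ℂ)} ∧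
    ∀ s : ℂ, (k : ℝ) < s.re →
      Z s = ∑' n : Fin k → ℕ, (x + ∑ i, (n i : ℂ) * ω i) ^ (-s)

/-- The continuation is unique, so the choice made in `multipleGamma` is immaterial. -/
theorem IsBarnesZeta.unique {k : ℕ} {x : ℂ} {ω : Fin k → ℂ} {Z Z' : ℂ → ℂ}
    (h : IsBarnesZeta x ω Z) (h' : IsBarnesZeta x ω Z') :
    Set.EqOn Z Z' {s : ℂ | ∀ j ∈ Finset.Icc 1 k, s ≠ (j : ℂ)} := by
  have hset : {s : ℂ | ∀ j ∈ Finset.Icc 1 k, s ≠ (j : ℂ)} =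
      (((Finset.Icc 1 k).image (fun j : ℕ => (j : ℂ)) : Finset ℂ) : Set ℂ)ᶜ := by
    ext s
    simp only [Set.mem_ofPred_eq, Set.mem_compl_iff, Finset.coe_image, Set.mem_image,
      Finset.mem_coe, not_exists, not_and]
    exact forall₂_congr fun j _ => ⟨fun h e => h e.symm, fun h e => h e.symm⟩
  have hopen : IsOpen {s : ℂ | ∀ j ∈ Finset.Icc 1 k, s ≠ (j : ℂ)} := by
    rw [hset]
    exact (Finset.finite_toSet _).isClosed.isOpen_compl
  have hconn : IsPreconnected {s : ℂ | ∀ j ∈ Finset.Icc 1 k, s ≠ (j : ℂ)} := by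
    rw [hset]
    exact ((Finset.finite_toSet _).countable.isConnected_compl_of_one_lt_rank
      (by rw [Complex.rank_real_complex]; norm_num)).isPreconnected
  have hhalf : IsOpen {s : ℂ | (k : ℝ) < s.re} :=
    isOpen_lt continuous_const Complex.continuous_re
  refine (h.1.analyticOnNhd hopen).eqOn_of_preconnected_of_eventuallyEq
    (h'.1.analyticOnNhd hopen) hconn (z₀ := (k : ℂ) + 1) ?_ ?_
  · intro j hj e
    have hle := (Finset.mem_Icc.mp hj).2
    have : k + 1 = j := by exact_mod_cast e
    omega
  · filter_upwards [hhalf.mem_nhds (by simp : ((k : ℂ) + 1) ∈ {s : ℂ | (k : ℝ) < s.re})]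
      with s hs
    rw [h.2 s hs, h'.2 s hs]

open Classical in
/-- Barnes' multiple gamma function `Γ_k(x | ω₁, …, ω_k) = exp(∂_s ζ_k(s, x | ω))|_{s = 0}`,
given the value `0` at its poles `x = -(n₁ ω₁ + ⋯ + n_k ω_k)`. -/
def multipleGamma {k : ℕ} (x : ℂ) (ω : Fin k → ℂ) : ℂ :=
  if ∃ n : Fin k → ℕ, x + ∑ i, (n i : ℂ) * ω i = 0 then 0
  else Complex.exp (deriv (Classical.epsilon (IsBarnesZeta x ω)) 0)

/-- Barnes' multiple sine function
`S_k(x | ω) = Γ_k(ω₁ + ⋯ + ω_k - x | ω)^{(-1)^k} Γ_k(x | ω)^{-1}`. -/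
def multipleSine {k : ℕ} (x : ℂ) (ω : Fin k → ℂ) : ℂ :=
  multipleGamma ((∑ i, ω i) - x) ω ^ ((-1 : ℤ) ^ k) * (multipleGamma x ω)⁻¹

/-! ### Conventions

The labels `1, …, N` are represented by `Fin N` (the label of `a` is `a + 1`).
A matrix `M` with entries `M_{i₁ i₂}^{j₁ j₂}` is indexed by `M (i₁, i₂) (j₁, j₂)`. -/

/-- `ω = exp(2πi/N)`. -/
def omega (N : ℕ) : ℂ := Complex.exp (2 * Real.pi * Complex.I / N)

/-- `ω^{b-a}`. -/
def omegaDiff (N : ℕ) (a b : Fin N) : ℂ := omega N ^ ((b.val : ℤ) - (a.val : ℤ))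

/-! ### The `R`-matrix of the double Yangian -/

/-- `ρ_{DY}(u) = Γ₁(u|N) Γ₁(u+N|N) / (Γ₁(u+1|N) Γ₁(u+N-1|N))`. -/
def rhoDY (N : ℕ) (u : ℂ) : ℂ :=
  multipleGamma u ![(N : ℂ)] * multipleGamma (u + N) ![(N : ℂ)] /
    (multipleGamma (u + 1) ![(N : ℂ)] * multipleGamma (u + N - 1) ![(N : ℂ)])

/-- Yang's matrix with `R_{aa}^{aa} = 1`, `R_{ab}^{ab} = u/(u+1)`, `R_{ab}^{ba} = 1/(u+1)`. -/
def yangR (N : ℕ) (u : ℂ) : Matrix (Fin N × Fin N) (Fin N × Fin N) ℂ :=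
  fun i j =>
    if i.1 = i.2 then (if j = i then 1 else 0)
    else if j = i then u / (u + 1)
    else if j = i.swap then 1 / (u + 1)
    else 0

/-- The `R`-matrix of the double Yangian of `sl_N`. -/
def dyR (N : ℕ) (u : ℂ) : Matrix (Fin N × Fin N) (Fin N × Fin N) ℂ :=
  rhoDY N u • yangR N u

/-! ### The `R`-matrix of the deformed double Yangian -/

/-- `ρ_{DYr}(u) = S₂(-u|r,N) S₂(1+u|r,N) / (S₂(u|r,N) S₂(1-u|r,N))`. -/
def rhoDYr (N : ℕ) (r u : ℂ) : ℂ :=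
  multipleSine (-u) ![r, (N : ℂ)] * multipleSine (1 + u) ![r, (N : ℂ)] /
    (multipleSine u ![r, (N : ℂ)] * multipleSine (1 - u) ![r, (N : ℂ)])

/-- `S̄_{a,b}^{c,a+b-c}(u,r)`, the upper indices being read modulo `N`. -/
def Sbar (N : ℕ) (r u : ℂ) : Matrix (Fin N × Fin N) (Fin N × Fin N) ℂ :=
  fun i j =>
    let a : ℂ := (i.1.val : ℂ)
    let b : ℂ := (i.2.val : ℂ)
    let c : ℂ := (j.1.val : ℂ)
    if i.1 + i.2 = j.1 + j.2 then
      Complex.sin (Real.pi / (N * r) * (u + 1 + (b - a) * r)) /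
        (Complex.sin (Real.pi / (N * r) * (u + (b - c) * r)) *
          Complex.sin (Real.pi / (N * r) * (1 - (a - c) * r)))
    else 0

/-- The trigonometric prefactor `sin(πu/r) sin(π/r) / (N sin(π(u+1)/r))`. -/
def prefactor (N : ℕ) (r u : ℂ) : ℂ :=
  1 / N * (Complex.sin (Real.pi * u / r) * Complex.sin (Real.pi / r) /
    Complex.sin (Real.pi * (u + 1) / r))

/-- The matrix `R̄(u,r)` of the deformed double Yangian of `sl_N` in its original gauge. -/
def Rbar (N : ℕ) (r u : ℂ) : Matrix (Fin N × Fin N) (Fin N × Fin N) ℂ :=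
  (-(rhoDYr N r u * prefactor N r u)) • Sbar N r u

/-- `V_i^j = N^{-1/2} ω^{(i-1) j}`, for labels `i, j = 1, …, N`. -/
def gaugeV (N : ℕ) : Matrix (Fin N) (Fin N) ℂ :=
  fun i j => ((Real.sqrt N : ℝ) : ℂ)⁻¹ * omega N ^ (i.val * (j.val + 1))

/-- `M ↦ (V ⊗ V) M (V ⊗ V)⁻¹`. -/
def gauge (N : ℕ) (M : Matrix (Fin N × Fin N) (Fin N × Fin N) ℂ) :
    Matrix (Fin N × Fin N) (Fin N × Fin N) ℂ :=
  (gaugeV N ⊗ₖ gaugeV N) * M * (gaugeV N ⊗ₖ gaugeV N)⁻¹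

/-- `S = (V ⊗ V) S̄ (V ⊗ V)⁻¹`. -/
def Smat (N : ℕ) (r u : ℂ) : Matrix (Fin N × Fin N) (Fin N × Fin N) ℂ :=
  gauge N (Sbar N r u)

/-- The `R`-matrix `R = (V ⊗ V) R̄ (V ⊗ V)⁻¹` of the deformed double Yangian of `sl_N`. -/
def dyrR (N : ℕ) (r u : ℂ) : Matrix (Fin N × Fin N) (Fin N × Fin N) ℂ :=
  gauge N (Rbar N r u)

/-! ### The twist -/

/-- `Γ((u-1)/r+1)/Γ(u/r+1) · ₂F₁(-1/r, (u-1)/r+1; u/r+1; z)`. -/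
def bFun (r z u : ℂ) : ℂ :=
  Complex.Gamma ((u - 1) / r + 1) / Complex.Gamma (u / r + 1) *
    ordinaryHypergeometric (-1 / r) ((u - 1) / r + 1) (u / r + 1) z

/-- `-(z/r) Γ((u-1)/r+1)/Γ(u/r+2) · ₂F₁(-1/r+1, (u-1)/r+1; u/r+2; z)`. -/
def cFun (r z u : ℂ) : ℂ :=
  -(z / r) * (Complex.Gamma ((u - 1) / r + 1) / Complex.Gamma (u / r + 2)) *
    ordinaryHypergeometric (-1 / r + 1) ((u - 1) / r + 1) (u / r + 2) z

/-- The twist `F(u)`: `F_{aa}^{aa} = 1`, and for `a ≠ b` the entries `F_{ab}^{ab} = b_{ab}(u)`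
and `F_{ab}^{ba} = c_{ab}(u)`; all other entries vanish. -/
def twistF (N : ℕ) (r u : ℂ) : Matrix (Fin N × Fin N) (Fin N × Fin N) ℂ :=
  fun i j =>
    if i.1 = i.2 then (if j = i then 1 else 0)
    else if j = i then bFun r (omegaDiff N i.1 i.2) u
    else if j = i.swap then cFun r (omegaDiff N i.1 i.2) u
    else 0

/-- `φ ⊗ 1` with `φ = diag(ω^{-a})`, `a = 1, …, N`. -/
def phiOne (N : ℕ) : Matrix (Fin N × Fin N) (Fin N × Fin N) ℂ :=
  Matrix.diagonal (fun a : Fin N => omega N ^ (-((a.val : ℤ) + 1))) ⊗ₖ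
    (1 : Matrix (Fin N) (Fin N) ℂ)

/-- `M₂₁`: the two tensor factors are exchanged. -/
def flip21 {N : ℕ} (M : Matrix (Fin N × Fin N) (Fin N × Fin N) ℂ) :
    Matrix (Fin N × Fin N) (Fin N × Fin N) ℂ :=
  M.submatrix Prod.swap Prod.swap

/-- `R^F(u) = F₂₁(-u) R(u) F₁₂(u)⁻¹`. -/
def twistedR (N : ℕ) (r u : ℂ) : Matrix (Fin N × Fin N) (Fin N × Fin N) ℂ :=
  flip21 (twistF N r (-u)) * dyR N u * (twistF N r u)⁻¹

/-- `F` has no singularity at `u + k r` and `R` none at `u + (k+1) r`, `k ≥ 0`, and `F(u)` is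
not degenerate. -/
def Regular (r u : ℂ) : Prop :=
  ∀ k : ℕ, u + (k + 1) * r ≠ 0 ∧ u - 1 + (k + 1) * r ≠ 0 ∧ u + 1 + (k + 1) * r ≠ 0

/-- None of `u`, `u + 1`, `u - 1` lies in `rℤ`. -/
def Generic (r u : ℂ) : Prop :=
  ∀ k : ℤ, u ≠ k * r ∧ u + 1 ≠ k * r ∧ u - 1 ≠ k * r

end

end DeformedYangian

namespace DeformedYangian

noncomputable section

open Filter Topology Complex

/-! ### Pochhammer symbols and Gauss' summation theorem -/

/-! All matrices except the Fourier gauge `V` and `Sbar` are supported on the identity and the flip,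
so matrix identities reduce to scalar ones on the `2 × 2` blocks spanned by `ab` and `ba`, with `z =
ω^{b-a}` on the unit circle, `z ≠ 1`. The series defining `b` and `c` have parameter excess `2/r`,
of positive real part, so they converge absolutely there, including at `z = 1`.

Claim 1 is a statement about contiguous hypergeometric functions. The shift `u ↦ u + r` raises the
last two parameters by one, and two contiguous relations (`bFun_add`, `cFun_add`) are exactly the
block form of the linear equation for `F`; eliminating one entry gives the second-order equations.
The block determinant satisfies a first-order recurrence, so a zero at `u` would persist at all `u +
m r`. But as `m → ∞` the determinant, divided by its Gamma factors, tends to `(1 - z)^{1/r} (1 -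
z⁻¹)^{1/r} ≠ 0` (`twistDet_ne_zero`).

For claim 2, the linear equation taken from `-u - r` to `-u`, together with the unitarity `Y(-u)
Y(u) = 1`, replaces the entries of `F₂₁(-u) Y(u)` by those of `F₂₁` at `-u - r`, up to the twist by
`φ`. These are hypergeometric series in `z⁻¹`, and the connection formula between `0` and `∞` writes
them through `F(u)`, with trigonometric coefficients that turn out to be the entries of `κ S`
(`bFun_connection`, `cFun_connection`).

The connection formula is proved without leaving the circle. Three solutions of a second-order
equation on the arc `0 < θ < 2π` are linearly dependent, and both ends of the arc are `z = 1`, where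
Gauss' theorem evaluates all three; the two resulting equations fix the coefficients
(`hypergeometric_connection`).

The entries of `S` come from `sin (x + y) / (sin x sin y) = cot x + cot y`: conjugation by `V` is a
discrete Fourier transform, which turns the two cotangents into finite Fourier sums, computed by
geometric series (`Smat_eq`, `cotSum_eq`). The normalising factors `rhoDY` and `rhoDYr` are only
carried along as scalars. -/

/-- The rising factorial `(s)_n`. -/
def poch (s : ℂ) (n : ℕ) : ℂ := (ascPochhammer ℂ n).eval s

@[simp] lemma poch_zero (s : ℂ) : poch s 0 = 1 := by simp [poch]

lemma poch_succ (s : ℂ) (n : ℕ) : poch s (n + 1) = poch s n * (s + n) := by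
  simp [poch, ascPochhammer_succ_eval]

lemma poch_succ_left (s : ℂ) (n : ℕ) : poch s (n + 1) = s * poch (s + 1) n := by
  simp [poch, ascPochhammer_succ_left, Polynomial.eval_comp]

lemma poch_eq_prod (s : ℂ) (n : ℕ) : poch s n = ∏ j ∈ Finset.range n, (s + j) := by
  induction n with
  | zero => simp
  | succ n ih => rw [poch_succ, ih, Finset.prod_range_succ]

lemma poch_ne_zero {s : ℂ} (hs : ∀ k : ℕ, s + k ≠ 0) (n : ℕ) : poch s n ≠ 0 := by
  rw [poch_eq_prod]
  exact Finset.prod_ne_zero_iff.mpr fun j _ => hs j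

lemma add_natCast_ne_zero {c : ℂ} (hc : ∀ k : ℕ, c + k ≠ 0) (m : ℕ) :
    ∀ k : ℕ, c + m + k ≠ 0 := fun k => by
  have := hc (m + k)
  rwa [Nat.cast_add, ← add_assoc] at this

lemma Gamma_ne_zero_of_add {s : ℂ} (hs : ∀ k : ℕ, s + k ≠ 0) : Gamma s ≠ 0 :=
  Gamma_ne_zero fun m h => hs m (by rw [h]; ring)

/-- Euler's limit for `Γ`, inverted so that it also holds at the poles. There `Gamma s` has the
default value `0`, whose inverse `0` is the true value of `1/Γ`, and the product on the left
vanishes for large `n`. -/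
lemma tendsto_poch_div (s : ℂ) :
    Tendsto (fun n : ℕ => poch s (n + 1) / ((n : ℂ) ^ s * n.factorial)) atTop
      (𝓝 (Gamma s)⁻¹) := by
  have heq : (fun n : ℕ => poch s (n + 1) / ((n : ℂ) ^ s * n.factorial)) =
      fun n => (GammaSeq s n)⁻¹ := by
    funext n
    rw [GammaSeq, poch_eq_prod, inv_div]
  by_cases hs : Gamma s = 0
  · obtain ⟨m, hm⟩ := (Gamma_eq_zero_iff s).mp hs
    rw [hs, inv_zero]
    refine tendsto_const_nhds.congr' ?_
    filter_upwards [eventually_ge_atTop m] with n hn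
    rw [poch_eq_prod, Finset.prod_eq_zero (i := m) (by simp; omega) (by rw [hm]; ring), zero_div]
  · rw [heq]
    exact (GammaSeq_tendsto_Gamma s).inv₀ hs

/-- The coefficients of `₂F₁(a, b; c; z)`. -/
def hypCoeff (a b c : ℂ) (n : ℕ) : ℂ := poch a n * poch b n / (poch c n * n.factorial)

lemma hypCoeff_comm (a b c : ℂ) (n : ℕ) : hypCoeff a b c n = hypCoeff b a c n := by
  rw [hypCoeff, hypCoeff, mul_comm (poch a n)]

@[simp] lemma hypCoeff_zero (a b c : ℂ) : hypCoeff a b c 0 = 1 := by simp [hypCoeff]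

lemma hypCoeff_succ (a b c : ℂ) (n : ℕ) :
    hypCoeff a b c (n + 1) = hypCoeff a b c n * ((a + n) * (b + n) / ((c + n) * (n + 1))) := by
  simp only [hypCoeff, poch_succ, Nat.factorial_succ]
  push_cast
  rw [div_mul_div_comm]
  congr 1 <;> ring

lemma ordinaryHypergeometric_eq (a b c z : ℂ) :
    ordinaryHypergeometric a b c z = ∑' n, hypCoeff a b c n * z ^ n := by
  rw [ordinaryHypergeometric_eq_tsum]
  refine tsum_congr fun n => ?_
  simp only [hypCoeff, poch, smul_eq_mul, div_eq_mul_inv, mul_inv]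
  ring

lemma ordinaryHypergeometric_comm (a b c z : ℂ) :
    ordinaryHypergeometric a b c z = ordinaryHypergeometric b a c z := by
  simp only [ordinaryHypergeometric_eq, hypCoeff_comm a b]

/-- By Euler's limit each `(s)_{n+1}` is comparable to `n^s n!`. The factor `n + 1` turns `(n+1)!`
into `n!`, so all factorials cancel and `n^{a+b-c}` remains. -/
lemma hypCoeff_isBigO (a b c : ℂ) (hc : ∀ k : ℕ, c + k ≠ 0) :
    (fun n : ℕ => ((n : ℂ) + 1) * hypCoeff a b c (n + 1)) =O[atTop]
      fun n : ℕ => (n : ℝ) ^ (-(c - a - b).re) := by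
  have h : Tendsto (fun n : ℕ => poch a (n + 1) / ((n : ℂ) ^ a * n.factorial) *
      (poch b (n + 1) / ((n : ℂ) ^ b * n.factorial)) /
      (poch c (n + 1) / ((n : ℂ) ^ c * n.factorial))) atTop
      (𝓝 ((Gamma a)⁻¹ * (Gamma b)⁻¹ / (Gamma c)⁻¹)) :=
    ((tendsto_poch_div a).mul (tendsto_poch_div b)).div (tendsto_poch_div c)
      (inv_ne_zero (Gamma_ne_zero_of_add hc))
  have h1 := h.isBigO_one ℝ
  have h2 : (fun n : ℕ => ((n : ℂ) + 1) * hypCoeff a b c (n + 1)) =ᶠ[atTop]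
      fun n : ℕ => (poch a (n + 1) / ((n : ℂ) ^ a * n.factorial) *
      (poch b (n + 1) / ((n : ℂ) ^ b * n.factorial)) /
      (poch c (n + 1) / ((n : ℂ) ^ c * n.factorial))) * (n : ℂ) ^ (-(c - a - b)) := by
    filter_upwards [eventually_ne_atTop 0] with n hn
    have hn' : (n : ℂ) ≠ 0 := Nat.cast_ne_zero.mpr hn
    have e : (n : ℂ) ^ (-(c - a - b)) = (n : ℂ) ^ a * (n : ℂ) ^ b / (n : ℂ) ^ c := by
      rw [← cpow_add _ _ hn', ← cpow_sub _ _ hn']; congr 1; ring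
    have ea : (n : ℂ) ^ a ≠ 0 := by simp [cpow_eq_zero_iff, hn]
    have eb : (n : ℂ) ^ b ≠ 0 := by simp [cpow_eq_zero_iff, hn]
    have ec : (n : ℂ) ^ c ≠ 0 := by simp [cpow_eq_zero_iff, hn]
    have hf : (n.factorial : ℂ) ≠ 0 := Nat.cast_ne_zero.mpr n.factorial_ne_zero
    have hp := poch_ne_zero hc (n + 1)
    have hn1 : (n : ℂ) + 1 ≠ 0 := Nat.cast_add_one_ne_zero n
    rw [e, hypCoeff, Nat.factorial_succ]
    push_cast
    field_simp
  refine h2.trans_isBigO ?_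
  have h3 : (fun n : ℕ => (n : ℂ) ^ (-(c - a - b))) =O[atTop]
      fun n : ℕ => (n : ℝ) ^ (-(c - a - b).re) := by
    refine Asymptotics.IsBigO.of_bound 1 ?_
    filter_upwards [eventually_gt_atTop 0] with n hn
    rw [norm_natCast_cpow_of_pos hn, one_mul, Real.norm_of_nonneg (by positivity)]
    simp
  simpa using h1.mul h3

lemma tendsto_nat_mul_hypCoeff {a b c : ℂ} (hc : ∀ k : ℕ, c + k ≠ 0) (h : 0 < (c - a - b).re) :
    Tendsto (fun n : ℕ => (n : ℂ) * hypCoeff a b c n) atTop (𝓝 0) := by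
  have h0 : Tendsto (fun n : ℕ => (n : ℝ) ^ (-(c - a - b).re)) atTop (𝓝 0) :=
    (tendsto_rpow_neg_atTop h).comp tendsto_natCast_atTop_atTop
  have := (hypCoeff_isBigO a b c hc).trans_tendsto h0
  rw [← tendsto_add_atTop_iff_nat 1]
  simpa using this

lemma summable_hypCoeff {a b c : ℂ} (hc : ∀ k : ℕ, c + k ≠ 0) (h : 0 < (c - a - b).re) :
    Summable fun n : ℕ => ‖hypCoeff a b c n‖ := by
  rw [← summable_nat_add_iff 1]
  refine summable_of_isBigO_nat (g := fun n : ℕ => (n : ℝ) ^ (-(c - a - b).re - 1))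
    (Real.summable_nat_rpow.mpr (by linarith)) ?_
  have h1 := hypCoeff_isBigO a b c hc
  have h2 : (fun n : ℕ => ((n : ℂ) + 1)⁻¹) =O[atTop] fun n : ℕ => ((n : ℝ))⁻¹ := by
    refine Asymptotics.IsBigO.of_bound 1 ?_
    filter_upwards [eventually_gt_atTop 0] with n hn
    have : (0 : ℝ) < n := Nat.cast_pos.mpr hn
    have e : ((n : ℂ) + 1) = ((n + 1 : ℝ) : ℂ) := by push_cast; rfl
    rw [one_mul, norm_inv, norm_inv, e, Complex.norm_real, Real.norm_of_nonneg (by positivity),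
      Real.norm_of_nonneg this.le]
    gcongr
    linarith
  refine Asymptotics.IsBigO.norm_left ?_
  refine ((h1.mul h2).congr' ?_ ?_)
  · filter_upwards with n
    have hn1 : (n : ℂ) + 1 ≠ 0 := Nat.cast_add_one_ne_zero n
    field_simp
  · filter_upwards [eventually_gt_atTop 0] with n hn
    have : (0 : ℝ) < n := Nat.cast_pos.mpr hn
    rw [Real.rpow_sub_one this.ne', div_eq_mul_inv]

lemma summable_hypCoeff_mul_pow {a b c z : ℂ} (hc : ∀ k : ℕ, c + k ≠ 0)
    (h : 0 < (c - a - b).re) (hz : ‖z‖ = 1) : Summable fun n : ℕ => hypCoeff a b c n * z ^ n :=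
  Summable.of_norm ((summable_hypCoeff hc h).congr fun n => by simp [hz])

/-- The termwise difference of the two sides telescopes: it is `-c` times the increment of `n ·
hypCoeff a b c n`, a sequence which starts at `0` and tends to `0` because the excess has positive
real part. -/
lemma tsum_hypCoeff_add_one {a b c : ℂ} (hc : ∀ k : ℕ, c + k ≠ 0) (h : 0 < (c - a - b).re) :
    c * (c - a - b) * ∑' n, hypCoeff a b c n =
      (c - a) * (c - b) * ∑' n, hypCoeff a b (c + 1) n := by
  have hc0 : c ≠ 0 := by simpa using hc 0
  have hc1 : ∀ k : ℕ, c + 1 + k ≠ 0 := by simpa using add_natCast_ne_zero hc 1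
  have h1 : 0 < (c + 1 - a - b).re := by simp at h ⊢; linarith
  have hcoef : ∀ n, hypCoeff a b (c + 1) n * (c + n) = c * hypCoeff a b c n := fun n => by
    have e : c * poch (c + 1) n = poch c n * (c + n) := by
      rw [← poch_succ, ← poch_succ_left]
    have := hc n
    have h2 := poch_ne_zero hc n
    have h3 := poch_ne_zero hc1 n
    have hf : (n.factorial : ℂ) ≠ 0 := Nat.cast_ne_zero.mpr n.factorial_ne_zero
    rw [hypCoeff, hypCoeff]
    field_simp
    linear_combination (-(poch a n * poch b n)) * e
  have hs := (summable_hypCoeff hc h).of_norm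
  have hs1 := (summable_hypCoeff hc1 h1).of_norm
  have key : ∀ n, c * (c - a - b) * hypCoeff a b c n - (c - a) * (c - b) * hypCoeff a b (c + 1) n
      = -c * ((((n + 1 : ℕ) : ℂ)) * hypCoeff a b c (n + 1) - (n : ℂ) * hypCoeff a b c n) := by
    intro n
    have h2 := hcoef n
    have h3 := hc n
    have h4 : (n : ℂ) + 1 ≠ 0 := Nat.cast_add_one_ne_zero n
    have h5 : hypCoeff a b (c + 1) n = c * hypCoeff a b c n / (c + n) := by
      rw [eq_div_iff h3, h2]
    rw [h5, hypCoeff_succ]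
    push_cast
    field_simp
    ring
  have hsum : HasSum (fun n => c * (c - a - b) * hypCoeff a b c n -
      (c - a) * (c - b) * hypCoeff a b (c + 1) n) 0 := by
    have hsm := (hs.mul_left (c * (c - a - b))).sub (hs1.mul_left ((c - a) * (c - b)))
    rw [hsm.hasSum_iff_tendsto_nat]
    have : ∀ m, ∑ n ∈ Finset.range m, (c * (c - a - b) * hypCoeff a b c n -
      (c - a) * (c - b) * hypCoeff a b (c + 1) n) = -c * ((m : ℂ) * hypCoeff a b c m) := by
      intro m
      rw [Finset.sum_congr rfl fun n _ => key n, ← Finset.mul_sum,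
        Finset.sum_range_sub (fun n : ℕ => (n : ℂ) * hypCoeff a b c n)]
      simp
    simp only [this]
    simpa using (tendsto_nat_mul_hypCoeff hc h).const_mul (-c)
  have h6 := hsum.tsum_eq
  rw [(hs.mul_left _).tsum_sub (hs1.mul_left _), tsum_mul_left, tsum_mul_left] at h6
  exact sub_eq_zero.mp h6

lemma norm_poch_le {c d : ℂ} (h : ∀ j : ℕ, ‖c + j‖ ≤ ‖d + j‖) (k : ℕ) :
    ‖poch c k‖ ≤ ‖poch d k‖ := by
  rw [poch_eq_prod, poch_eq_prod, norm_prod, norm_prod]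
  exact Finset.prod_le_prod (fun _ _ => norm_nonneg _) fun j _ => h j

lemma tendsto_norm_add_natCast (c : ℂ) : Tendsto (fun m : ℕ => ‖c + m‖) atTop atTop := by
  refine tendsto_atTop_mono (f := fun m : ℕ => (m : ℝ) - ‖c‖) (fun m => ?_)
    (tendsto_atTop_add_const_right _ _ tendsto_natCast_atTop_atTop)
  have := norm_sub_norm_le (m : ℂ) (-c)
  rwa [norm_neg, sub_neg_eq_add, add_comm (m : ℂ), norm_natCast] at this

/-- Every term but the constant one has a denominator growing with `m`; the series at `m = 0` serves
as majorant. -/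
lemma tendsto_tsum_hypCoeff_add {a b c : ℂ} (hc : ∀ k : ℕ, c + k ≠ 0)
    (h : 0 < (c - a - b).re) :
    Tendsto (fun m : ℕ => ∑' n, hypCoeff a b (c + m) n) atTop (𝓝 1) := by
  have e1 : (1 : ℂ) = ∑' n : ℕ, if n = 0 then 1 else 0 := by simp
  rw [e1]
  refine tendsto_tsum_of_dominated_convergence (summable_hypCoeff hc h) (fun k => ?_) ?_
  · rcases k with _ | k
    · simp
    · simp only [Nat.succ_ne_zero, if_false]
      have h1 : Tendsto (fun m : ℕ => ‖poch (c + m) (k + 1)‖) atTop atTop := by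
        simp only [poch_eq_prod, norm_prod]
        induction k with
        | zero => simpa using tendsto_norm_add_natCast c
        | succ k ih =>
          simp only [Finset.prod_range_succ _ (k + 1)]
          refine ih.atTop_mul_atTop₀ ?_
          refine (tendsto_norm_add_natCast (c + ((k + 1 : ℕ) : ℂ))).congr fun m => ?_
          congr 1; ring
      rw [tendsto_zero_iff_norm_tendsto_zero]
      have h2 := h1.inv_tendsto_atTop.const_mul
        (‖poch a (k + 1) * poch b (k + 1) / (k + 1).factorial‖)
      rw [mul_zero] at h2
      refine h2.congr fun m => ?_
      simp only [hypCoeff, norm_mul, norm_div, Pi.inv_apply]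
      rw [div_mul_eq_div_div_swap]
      rfl
  -- The bound comes from `|c + m + j|² - |c + j|² = m (m + 2 Re c + 2 j)`, which is nonnegative for
  -- every `j` once `m ≥ -2 Re c`.
  · obtain ⟨M, hM⟩ := exists_nat_ge (-2 * c.re)
    filter_upwards [eventually_ge_atTop M] with m hm k
    have hle : ‖poch c k‖ ≤ ‖poch (c + m) k‖ := by
      refine norm_poch_le (fun j => ?_) k
      have hm' : -2 * c.re ≤ m := hM.trans (by exact_mod_cast hm)
      rw [← sq_le_sq₀ (norm_nonneg _) (norm_nonneg _), Complex.sq_norm, Complex.sq_norm,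
        normSq_apply, normSq_apply]
      simp only [add_re, natCast_re, add_im, natCast_im, add_zero]
      have hj : (0 : ℝ) ≤ j := Nat.cast_nonneg j
      have hm0 : (0 : ℝ) ≤ m := Nat.cast_nonneg m
      nlinarith [mul_nonneg hm0 hj, mul_nonneg hm0 (by linarith : 0 ≤ (m : ℝ) + 2 * c.re)]
    have hp : 0 < ‖poch c k‖ := norm_pos_iff.mpr (poch_ne_zero hc k)
    have hf : 0 < ‖(k.factorial : ℂ)‖ :=
      norm_pos_iff.mpr (Nat.cast_ne_zero.mpr k.factorial_ne_zero)
    simp only [hypCoeff, norm_mul, norm_div]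
    gcongr

/-- **Gauss' summation theorem**. -/
theorem tsum_hypCoeff {a b c : ℂ} (hc : ∀ k : ℕ, c + k ≠ 0) (h : 0 < (c - a - b).re) :
    ∑' n, hypCoeff a b c n = Gamma c * Gamma (c - a - b) / (Gamma (c - a) * Gamma (c - b)) := by
  have hs : ∀ k : ℕ, c - a - b + k ≠ 0 := fun k e => by
    have := congrArg re e
    simp only [add_re, natCast_re, zero_re] at this
    have hk : (0 : ℝ) ≤ k := Nat.cast_nonneg k
    linarith
  -- The recurrence in `c` is iterated `m` times and then `m → ∞`: the shifted series tends to `1`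
  -- and the Pochhammer quotients to Gamma quotients. The powers of `m` cancel because `c + (c - a -
  -- b) = (c - a) + (c - b)`.
  have hiter : ∀ m : ℕ, poch c m * poch (c - a - b) m * ∑' n, hypCoeff a b c n =
      poch (c - a) m * poch (c - b) m * ∑' n, hypCoeff a b (c + m) n := by
    intro m
    induction m with
    | zero => simp
    | succ m ih =>
      have hre : 0 < (c + m - a - b).re := by
        have hk : (0 : ℝ) ≤ m := Nat.cast_nonneg m
        simp at h ⊢; linarith
      have := tsum_hypCoeff_add_one (a := a) (b := b) (add_natCast_ne_zero hc m) hre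
      rw [poch_succ, poch_succ, poch_succ, poch_succ]
      push_cast
      rw [← add_assoc]
      linear_combination ((c + m) * (c - a - b + m)) * ih + poch (c - a) m * poch (c - b) m * this
  have hlim : Tendsto (fun m : ℕ =>
      (poch (c - a) (m + 1) / ((m : ℂ) ^ (c - a) * m.factorial)) *
      (poch (c - b) (m + 1) / ((m : ℂ) ^ (c - b) * m.factorial)) /
      ((poch c (m + 1) / ((m : ℂ) ^ c * m.factorial)) *
      (poch (c - a - b) (m + 1) / ((m : ℂ) ^ (c - a - b) * m.factorial))) *
      ∑' n, hypCoeff a b (c + (m + 1 : ℕ)) n) atTop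
      (𝓝 ((Gamma (c - a))⁻¹ * (Gamma (c - b))⁻¹ / ((Gamma c)⁻¹ * (Gamma (c - a - b))⁻¹) * 1)) := by
    refine Tendsto.mul (Tendsto.div ((tendsto_poch_div _).mul (tendsto_poch_div _))
      ((tendsto_poch_div _).mul (tendsto_poch_div _)) (mul_ne_zero
        (inv_ne_zero (Gamma_ne_zero_of_add hc)) (inv_ne_zero (Gamma_ne_zero_of_add hs))))
      ((tendsto_add_atTop_iff_nat 1).mpr (tendsto_tsum_hypCoeff_add hc h))
  have hconst : Tendsto (fun _ : ℕ => ∑' n, hypCoeff a b c n) atTop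
      (𝓝 ((Gamma (c - a))⁻¹ * (Gamma (c - b))⁻¹ / ((Gamma c)⁻¹ * (Gamma (c - a - b))⁻¹) * 1)) := by
    refine hlim.congr' ?_
    filter_upwards [eventually_ne_atTop 0] with m hm
    have hm' : (m : ℂ) ≠ 0 := Nat.cast_ne_zero.mpr hm
    have e : (m : ℂ) ^ c * (m : ℂ) ^ (c - a - b) = (m : ℂ) ^ (c - a) * (m : ℂ) ^ (c - b) := by
      rw [← cpow_add _ _ hm', ← cpow_add _ _ hm']; congr 1; ring
    have e1 : (m : ℂ) ^ c ≠ 0 := by simp [cpow_eq_zero_iff, hm]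
    have e2 : (m : ℂ) ^ (c - a - b) ≠ 0 := by simp [cpow_eq_zero_iff, hm]
    have e3 : (m : ℂ) ^ (c - a) ≠ 0 := by simp [cpow_eq_zero_iff, hm]
    have e4 : (m : ℂ) ^ (c - b) ≠ 0 := by simp [cpow_eq_zero_iff, hm]
    have hf : (m.factorial : ℂ) ≠ 0 := Nat.cast_ne_zero.mpr m.factorial_ne_zero
    have p1 := poch_ne_zero hc (m + 1)
    have p2 := poch_ne_zero hs (m + 1)
    have := hiter (m + 1)
    set T := ∑' n, hypCoeff a b (c + (m + 1 : ℕ)) n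
    set T0 := ∑' n, hypCoeff a b c n
    have hT0 : T0 = poch (c - a) (m + 1) * poch (c - b) (m + 1) * T /
        (poch c (m + 1) * poch (c - a - b) (m + 1)) := by
      rw [eq_div_iff (mul_ne_zero p1 p2)]; linear_combination this
    rw [hT0]
    generalize poch (c - a) (m + 1) = A, poch (c - b) (m + 1) = B at *
    field_simp
    linear_combination (A * B * T) * e
  rw [tendsto_nhds_unique tendsto_const_nhds hconst, mul_one, div_eq_mul_inv, mul_inv, inv_inv,
    inv_inv, div_eq_mul_inv, mul_inv]
  ring

end

end DeformedYangian

namespace DeformedYangian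

noncomputable section

open Filter Topology Complex

/-! ### The hypergeometric equation on the unit circle -/

/-- The sum of a power series at `e^{iθ}`. -/
def circleSum (t : ℕ → ℂ) (θ : ℝ) : ℂ := ∑' n, t n * exp (I * θ) ^ n

/-- The shifted sequence `(0, t₀, t₁, …)`. -/
def prev (t : ℕ → ℂ) : ℕ → ℂ
  | 0 => 0
  | n + 1 => t n

/-- The coefficients of `(1 - z) z f'(z)` for `f(z) = ∑ tₙ zⁿ`. -/
def eulerCoeff (t : ℕ → ℂ) (n : ℕ) : ℂ := n * t n - (n - 1) * prev t n

lemma summable_circle {t : ℕ → ℂ} (ht : Summable fun n => ‖t n‖) (θ : ℝ) :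
    Summable fun n => t n * exp (I * θ) ^ n :=
  Summable.of_norm (ht.congr fun n => by simp)

lemma summable_prev {t : ℕ → ℂ} (ht : Summable fun n => ‖t n‖) :
    Summable fun n => ‖prev t n‖ := by
  rw [← summable_nat_add_iff 1]; exact ht

lemma circleSum_prev {t : ℕ → ℂ} (ht : Summable fun n => ‖t n‖) (θ : ℝ) :
    circleSum (prev t) θ = exp (I * θ) * circleSum t θ := by
  rw [circleSum, (summable_circle (summable_prev ht) θ).tsum_eq_zero_add, circleSum,
    ← tsum_mul_left]
  simp only [prev, zero_mul, zero_add]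
  exact tsum_congr fun n => by ring

lemma circleSum_add {t s : ℕ → ℂ} (ht : Summable fun n => ‖t n‖) (hs : Summable fun n => ‖s n‖)
    (θ : ℝ) : circleSum (fun n => t n + s n) θ = circleSum t θ + circleSum s θ := by
  rw [circleSum, circleSum, circleSum,
    ← (summable_circle ht θ).tsum_add (summable_circle hs θ)]
  exact tsum_congr fun n => by ring

lemma circleSum_mul (x : ℂ) (t : ℕ → ℂ) (θ : ℝ) :
    circleSum (fun n => x * t n) θ = x * circleSum t θ := by
  rw [circleSum, circleSum, ← tsum_mul_left]
  exact tsum_congr fun n => by ring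

lemma continuous_circleSum {t : ℕ → ℂ} (ht : Summable fun n => ‖t n‖) :
    Continuous (circleSum t) :=
  continuous_tsum (fun n => by fun_prop) ht fun n θ => by simp

lemma hasDerivAt_exp_I (θ : ℝ) :
    HasDerivAt (fun x : ℝ => exp (I * x)) (I * exp (I * θ)) θ := by
  have := ((hasDerivAt_id (θ : ℂ)).const_mul I).cexp.comp_ofReal
  simpa [mul_comm] using this

/-- The series `f` need not be differentiable term by term on the circle, but `(1 - z) f` is: its
coefficients `d n = t n - t (n-1)` satisfy `n d n = eulerCoeff t n - t (n-1)`, which is summable.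
Dividing by `1 - z ≠ 0` recovers `f`. -/
lemma hasDerivAt_circleSum {t : ℕ → ℂ} (ht : Summable fun n => ‖t n‖)
    (hs : Summable fun n => ‖eulerCoeff t n‖) {θ : ℝ} (hθ : exp (I * θ) ≠ 1) :
    HasDerivAt (circleSum t) (I / (1 - exp (I * θ)) * circleSum (eulerCoeff t) θ) θ := by
  have hp := summable_prev ht
  set d : ℕ → ℂ := fun n => t n + (-1) * prev t n with hd
  have hnd : ∀ n : ℕ, (n : ℂ) * d n = eulerCoeff t n + (-1) * prev t n := fun n => by
    simp only [hd, eulerCoeff]; ring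
  have hp' : Summable fun n => ‖(-1) * prev t n‖ := by simpa using hp
  have hsd : Summable fun n : ℕ => ‖(n : ℂ) * d n‖ := by
    simp only [hnd]
    exact (hs.add hp').of_nonneg_of_le (fun n => norm_nonneg _) fun n => norm_add_le _ _
  have hdd : Summable fun n => ‖d n‖ :=
    (ht.add hp').of_nonneg_of_le (fun n => norm_nonneg _) fun n => norm_add_le _ _
  have hg : HasDerivAt (circleSum d)
      (∑' n : ℕ, d n * (n * (I * exp (I * θ) ^ n))) θ := by
    refine hasDerivAt_tsum (u := fun n : ℕ => ‖(n : ℂ) * d n‖)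
      (g := fun (n : ℕ) x => d n * exp (I * (x : ℝ)) ^ n)
      (g' := fun (n : ℕ) x => d n * (n * (I * exp (I * (x : ℝ)) ^ n))) hsd (fun n y => ?_)
      (fun n y => ?_) (summable_circle hdd 0) θ
    · refine (HasDerivAt.const_mul (d n) ((hasDerivAt_exp_I y).pow n)).congr_deriv ?_
      rcases n with _ | n
      · simp
      · simp only [Nat.add_sub_cancel]; ring
    · simp [mul_comm]
  have hgv : (∑' n : ℕ, d n * (n * (I * exp (I * θ) ^ n))) =
      I * (circleSum (eulerCoeff t) θ - exp (I * θ) * circleSum t θ) := by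
    rw [sub_eq_add_neg, ← neg_one_mul, ← circleSum_prev ht, ← circleSum_mul,
      ← circleSum_add hs hp', ← circleSum_mul]
    refine tsum_congr fun n => ?_
    beta_reduce
    rw [← hnd]; ring
  have hfg : ∀ x : ℝ, circleSum d x = (1 - exp (I * x)) * circleSum t x := fun x => by
    rw [hd, circleSum_add ht hp', circleSum_mul, circleSum_prev ht]; ring
  have h1 : (1 : ℂ) - exp (I * θ) ≠ 0 := sub_ne_zero.mpr (Ne.symm hθ)
  have hq := hg.div ((hasDerivAt_exp_I θ).const_sub 1) h1
  have hev : ∀ᶠ x : ℝ in 𝓝 θ, (1 : ℂ) - exp (I * x) ≠ 0 :=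
    (by fun_prop : Continuous fun x : ℝ => (1 : ℂ) - exp (I * x)).continuousAt.eventually_ne h1
  refine (hq.congr_of_eventuallyEq ?_).congr_deriv ?_
  · filter_upwards [hev] with x hx
    rw [Pi.div_apply, hfg, mul_div_cancel_left₀ _ hx]
  · rw [hgv, hfg]
    field_simp
    ring

/-- The leading terms of `(a+n)(b+n)/(c+n)` and `n` cancel, leaving a bounded factor. Hence `(1 - z)
z f'` is absolutely convergent on the circle whenever `f` is. -/
lemma eulerCoeff_hypCoeff_succ {a b c : ℂ} (hc : ∀ k : ℕ, c + k ≠ 0) (n : ℕ) :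
    eulerCoeff (hypCoeff a b c) (n + 1) =
      hypCoeff a b c n * ((a * b + (a + b - c) * n) / (c + n)) := by
  have h1 := hc n
  have h2 : (n : ℂ) + 1 ≠ 0 := Nat.cast_add_one_ne_zero n
  simp only [eulerCoeff, prev, hypCoeff_succ]
  push_cast
  field_simp
  ring

lemma summable_eulerCoeff {a b c : ℂ} (hc : ∀ k : ℕ, c + k ≠ 0) (h : 0 < (c - a - b).re) :
    Summable fun n => ‖eulerCoeff (hypCoeff a b c) n‖ := by
  rw [← summable_nat_add_iff 1]
  have hb := (tendsto_add_mul_div_add_mul_atTop_nhds (a * b) c (a + b - c)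
    (one_ne_zero (α := ℂ))).isBigO_one ℝ
  simp only [one_mul] at hb
  refine summable_of_isBigO_nat (summable_hypCoeff hc h) (Asymptotics.IsBigO.norm_left ?_)
  simp only [eulerCoeff_hypCoeff_succ hc]
  simpa using ((Asymptotics.isBigO_refl (fun n => hypCoeff a b c n) atTop).norm_right.mul hb)

/-- This is the hypergeometric equation in coefficients. The right side involves only shifts of
sequences already known to be summable, so it yields both the equation for `h = (1 - z) z f'` and
the summability needed to differentiate `h`. -/
lemma eulerCoeff_eulerCoeff {a b c : ℂ} (hc : ∀ k : ℕ, c + k ≠ 0) (n : ℕ) :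
    eulerCoeff (eulerCoeff (hypCoeff a b c)) n =
      (a + b - 1) * prev (eulerCoeff (hypCoeff a b c)) n +
        (-(c - 1) * eulerCoeff (hypCoeff a b c) n +
          (a * b * prev (hypCoeff a b c) n +
            -(a * b) * prev (prev (hypCoeff a b c)) n)) := by
  rcases n with _ | _ | n
  · simp [eulerCoeff, prev]
  · have h0 : c ≠ 0 := by simpa using hc 0
    have e1 := eulerCoeff_hypCoeff_succ (a := a) (b := b) hc 0
    simp only [eulerCoeff, prev] at e1 ⊢
    simp only [zero_add, hypCoeff_zero, Nat.cast_one] at e1 ⊢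
    simp only [Nat.cast_zero, mul_zero, add_zero, sub_self] at e1 ⊢
    have e2 : hypCoeff a b c 1 * c = a * b := by
      linear_combination c * e1 + mul_div_cancel₀ (a * b) h0
    linear_combination e2
  · have e1 := eulerCoeff_hypCoeff_succ (a := a) (b := b) hc (n + 1)
    have e2 := eulerCoeff_hypCoeff_succ (a := a) (b := b) hc n
    rw [eulerCoeff]
    simp only [prev]
    rw [e1, e2, hypCoeff_succ]
    have h1 := hc n
    have h2 : (n : ℂ) + 1 ≠ 0 := Nat.cast_add_one_ne_zero n
    have h3 := hc (n + 1)
    push_cast at h3 ⊢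
    field_simp
    ring

lemma summable_eulerCoeff_eulerCoeff {a b c : ℂ} (hc : ∀ k : ℕ, c + k ≠ 0)
    (h : 0 < (c - a - b).re) :
    Summable fun n => ‖eulerCoeff (eulerCoeff (hypCoeff a b c)) n‖ := by
  have h0 := summable_hypCoeff hc h
  have h1 := summable_eulerCoeff hc h
  simp only [eulerCoeff_eulerCoeff hc]
  refine (((summable_prev h1).mul_left ‖a + b - 1‖).add ((h1.mul_left ‖-(c - 1)‖).add
    (((summable_prev h0).mul_left ‖a * b‖).add
      ((summable_prev (summable_prev h0)).mul_left ‖-(a * b)‖)))).of_nonneg_of_le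
    (fun n => norm_nonneg _) fun n => ?_
  simp only [← norm_mul]
  exact (norm_add_le _ _).trans (add_le_add le_rfl ((norm_add_le _ _).trans
    (add_le_add le_rfl (norm_add_le _ _))))

lemma circleSum_eulerCoeff_eulerCoeff {a b c : ℂ} (hc : ∀ k : ℕ, c + k ≠ 0)
    (h : 0 < (c - a - b).re) (θ : ℝ) :
    circleSum (eulerCoeff (eulerCoeff (hypCoeff a b c))) θ =
      ((a + b - 1) * exp (I * θ) - (c - 1)) * circleSum (eulerCoeff (hypCoeff a b c)) θ +
        a * b * exp (I * θ) * (1 - exp (I * θ)) * circleSum (hypCoeff a b c) θ := by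
  have h0 := summable_hypCoeff hc h
  have h1 := summable_eulerCoeff hc h
  have hm : ∀ {t : ℕ → ℂ} (x : ℂ), (Summable fun n => ‖t n‖) → Summable fun n => ‖x * t n‖ :=
    fun x ht => by simpa only [norm_mul] using ht.mul_left ‖x‖
  have hA : ∀ {t s : ℕ → ℂ}, (Summable fun n => ‖t n‖) → (Summable fun n => ‖s n‖) →
      Summable fun n => ‖t n + s n‖ := fun ht hs =>
    (ht.add hs).of_nonneg_of_le (fun n => norm_nonneg _) fun n => norm_add_le _ _
  have e : eulerCoeff (eulerCoeff (hypCoeff a b c)) = _ := funext (eulerCoeff_eulerCoeff hc)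
  have p0 := summable_prev h0
  have p00 := summable_prev p0
  have p1 := summable_prev h1
  rw [e, circleSum_add (hm _ p1) (hA (hm _ h1) (hA (hm _ p0) (hm _ p00))),
    circleSum_add (hm _ h1) (hA (hm _ p0) (hm _ p00)), circleSum_add (hm _ p0) (hm _ p00),
    circleSum_mul, circleSum_mul, circleSum_mul, circleSum_mul, circleSum_prev h1,
    circleSum_prev p0, circleSum_prev h0]
  ring

/-- `(f, h)` with `h = (1 - z) z f'` solves the first order system equivalent to the
hypergeometric equation along `z = e^{iθ}`, `0 < θ < 2π`. -/
def IsCircleSolution (a b c : ℂ) (f h : ℝ → ℂ) : Prop :=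
  ∀ θ ∈ Set.Ioo 0 (2 * Real.pi),
    HasDerivAt f (I / (1 - exp (I * θ)) * h θ) θ ∧
    HasDerivAt h (I / (1 - exp (I * θ)) * (((a + b - 1) * exp (I * θ) - (c - 1)) * h θ +
      a * b * exp (I * θ) * (1 - exp (I * θ)) * f θ)) θ

lemma exp_I_mul_ne_one {θ : ℝ} (hθ : θ ∈ Set.Ioo 0 (2 * Real.pi)) : exp (I * θ) ≠ 1 := by
  rw [mul_comm]
  intro h
  obtain ⟨n, hn⟩ := exp_eq_one_iff.mp h
  have h2 : (θ : ℂ) = ((n * (2 * Real.pi) : ℝ) : ℂ) := by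
    apply mul_right_cancel₀ I_ne_zero
    rw [hn]; push_cast; ring
  have h3 : θ = n * (2 * Real.pi) := by exact_mod_cast h2
  have hp := Real.two_pi_pos
  have h4 : (0 : ℝ) < n := by
    by_contra hcon
    nlinarith [hθ.1]
  have h5 : (n : ℝ) < 1 := by
    by_contra hcon
    nlinarith [hθ.2]
  have h6 : (0 : ℤ) < n := by exact_mod_cast h4
  have h7 : n < (1 : ℤ) := by exact_mod_cast h5
  omega

lemma isCircleSolution_hyp {a b c : ℂ} (hc : ∀ k : ℕ, c + k ≠ 0) (h : 0 < (c - a - b).re) :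
    IsCircleSolution a b c (circleSum (hypCoeff a b c))
      (circleSum (eulerCoeff (hypCoeff a b c))) := fun θ hθ => by
  have hz := exp_I_mul_ne_one hθ
  refine ⟨hasDerivAt_circleSum (summable_hypCoeff hc h) (summable_eulerCoeff hc h) hz, ?_⟩
  rw [← circleSum_eulerCoeff_eulerCoeff hc h]
  exact hasDerivAt_circleSum (summable_eulerCoeff hc h) (summable_eulerCoeff_eulerCoeff hc h) hz

/-- The solution at infinity, `(-z)^{-a} ₂F₁(a, a-c+1; a-b+1; 1/z)`; the exponential is the branch
of `(-z)^{-a}` that is smooth along the arc and equals `1` at `θ = π`. Its series has the same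
excess `c - a - b`. In the second function, the chain rule for `1/z` gives the term `z ·
eulerCoeff`, since `-(1 - z) = z (1 - 1/z)`. -/
lemma isCircleSolution_inv {a b c : ℂ} (hc : ∀ k : ℕ, a - b + 1 + k ≠ 0)
    (h : 0 < (c - a - b).re) :
    IsCircleSolution a b c
      (fun θ => exp (-(I * a * (θ - Real.pi))) *
        circleSum (hypCoeff a (a - c + 1) (a - b + 1)) (-θ))
      (fun θ => exp (-(I * a * (θ - Real.pi))) *
        (-a * (1 - exp (I * θ)) * circleSum (hypCoeff a (a - c + 1) (a - b + 1)) (-θ) +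
          exp (I * θ) * circleSum (eulerCoeff (hypCoeff a (a - c + 1) (a - b + 1))) (-θ))) :=
    fun θ hθ => by
  have hz := exp_I_mul_ne_one hθ
  have hw : exp (I * (-θ : ℝ)) = (exp (I * θ))⁻¹ := by
    rw [← exp_neg]; push_cast; congr 1; ring
  have hw1 : exp (I * (-θ : ℝ)) ≠ 1 := by
    rw [hw]; intro e; exact hz (inv_eq_one.mp e)
  have hre : 0 < (a - b + 1 - a - (a - c + 1)).re := by
    simp at h ⊢; linarith
  have dF := (hasDerivAt_circleSum (summable_hypCoeff hc hre) (summable_eulerCoeff hc hre)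
    hw1).scomp θ (hasDerivAt_neg θ)
  have dH := (hasDerivAt_circleSum (summable_eulerCoeff hc hre)
    (summable_eulerCoeff_eulerCoeff hc hre) hw1).scomp θ (hasDerivAt_neg θ)
  rw [circleSum_eulerCoeff_eulerCoeff hc hre, hw] at dH
  rw [hw] at dF
  have dE : HasDerivAt (fun x : ℝ => exp (-(I * a * (x - Real.pi))))
      (-(I * a) * exp (-(I * a * (θ - Real.pi)))) θ := by
    have := (((hasDerivAt_id (θ : ℂ)).sub_const (Real.pi : ℂ)).const_mul
      (I * a)).neg.cexp.comp_ofReal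
    simpa [mul_comm] using this
  have dz := hasDerivAt_exp_I θ
  have h0 : exp (I * θ) ≠ 0 := exp_ne_zero _
  have h1 : (1 : ℂ) - exp (I * θ) ≠ 0 := sub_ne_zero.mpr (Ne.symm hz)
  have h2 : exp (I * θ) - 1 ≠ 0 := sub_ne_zero.mpr hz
  have h3 : (1 : ℂ) - (exp (I * θ))⁻¹ = -(1 - exp (I * θ)) / exp (I * θ) := by
    field_simp; ring
  rw [h3] at dF dH
  constructor
  · refine (dE.mul dF).congr_deriv ?_
    simp only [Function.comp, neg_smul, one_smul]
    field_simp
  · refine (dE.mul ((((dz.const_sub 1).const_mul (-a)).mul dF).add (dz.mul dH))).congr_deriv ?_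
    simp only [Function.comp, neg_smul, one_smul, Pi.add_apply, Pi.mul_apply]
    field_simp
    ring

lemma IsCircleSolution.comm {a b c : ℂ} {f h : ℝ → ℂ} (H : IsCircleSolution b a c f h) :
    IsCircleSolution a b c f h := fun θ hθ => by
  rw [add_comm a, mul_comm a]
  exact H θ hθ

lemma IsCircleSolution.sum {a b c : ℂ} {ι : Type*} [Fintype ι] {f h : ι → ℝ → ℂ}
    (H : ∀ i, IsCircleSolution a b c (f i) (h i)) (g : ι → ℂ) :
    IsCircleSolution a b c (fun θ => ∑ i, g i * f i θ) (fun θ => ∑ i, g i * h i θ) :=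
    fun θ hθ => by
  constructor
  · refine (HasDerivAt.fun_sum fun i _ => ((H i θ hθ).1.const_mul (g i))).congr_deriv ?_
    rw [Finset.mul_sum]
    exact Finset.sum_congr rfl fun i _ => by ring
  · refine (HasDerivAt.fun_sum fun i _ => ((H i θ hθ).2.const_mul (g i))).congr_deriv ?_
    rw [Finset.mul_sum, Finset.mul_sum, ← Finset.sum_add_distrib, Finset.mul_sum]
    exact Finset.sum_congr rfl fun i _ => by ring

/-- Uniqueness for a linear system with initial time `π`. The coefficients blow up at both ends of
the arc, so the comparison is made on `(ε, 2π - ε)`, with `ε` small enough to contain `π` and `θ`;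
there the coefficients are bounded and the system is Lipschitz. -/
lemma IsCircleSolution.eq_zero {a b c : ℂ} {f h : ℝ → ℂ} (H : IsCircleSolution a b c f h)
    (hf : f Real.pi = 0) (hh : h Real.pi = 0) {θ : ℝ} (hθ : θ ∈ Set.Ioo 0 (2 * Real.pi)) :
    f θ = 0 := by
  have hpi := Real.pi_pos
  obtain ⟨ε, hε0, hε⟩ : ∃ ε, 0 < ε ∧ ε < min Real.pi (min θ (2 * Real.pi - θ)) :=
    exists_between (lt_min hpi (lt_min hθ.1 (by linarith [hθ.2])))
  rw [lt_min_iff, lt_min_iff] at hε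
  obtain ⟨he1, he2, he3⟩ := hε
  set p : ℝ → ℂ := fun t => I / (1 - exp (I * t))
  set q : ℝ → ℂ := fun t => p t * ((a + b - 1) * exp (I * t) - (c - 1))
  set s : ℝ → ℂ := fun t => p t * (a * b * exp (I * t) * (1 - exp (I * t)))
  set A : ℝ → ℂ × ℂ →L[ℂ] ℂ × ℂ := fun t =>
    (p t • ContinuousLinearMap.snd ℂ ℂ ℂ).prod
      (q t • ContinuousLinearMap.snd ℂ ℂ ℂ + s t • ContinuousLinearMap.fst ℂ ℂ ℂ)
  have hsub : Set.Icc ε (2 * Real.pi - ε) ⊆ Set.Ioo 0 (2 * Real.pi) := fun t ht =>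
    ⟨by linarith [ht.1], by linarith [ht.2]⟩
  have hp : ContinuousOn p (Set.Icc ε (2 * Real.pi - ε)) := by
    refine ContinuousOn.div (by fun_prop) (by fun_prop) fun t ht => ?_
    exact sub_ne_zero.mpr (Ne.symm (exp_I_mul_ne_one (hsub ht)))
  have hq : ContinuousOn q (Set.Icc ε (2 * Real.pi - ε)) := hp.mul (by fun_prop)
  have hs : ContinuousOn s (Set.Icc ε (2 * Real.pi - ε)) := hp.mul (by fun_prop)
  obtain ⟨P, hP⟩ := isCompact_Icc.exists_bound_of_continuousOn hp
  obtain ⟨Q, hQ⟩ := isCompact_Icc.exists_bound_of_continuousOn hq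
  obtain ⟨S, hS⟩ := isCompact_Icc.exists_bound_of_continuousOn hs
  have hlip : ∀ t ∈ Set.Ioo ε (2 * Real.pi - ε),
      LipschitzOnWith (Real.toNNReal (max P (Q + S))) (A t) Set.univ := by
    intro t ht
    have ht' := Set.Ioo_subset_Icc_self ht
    refine LipschitzWith.lipschitzOnWith (LipschitzWith.of_dist_le_mul fun x y => ?_)
    rw [dist_eq_norm, dist_eq_norm, ← map_sub]
    set v := x - y
    have h1 := norm_fst_le v
    have h2 := norm_snd_le v
    have hP0 := (norm_nonneg _).trans (hP t ht')
    have hQ0 := (norm_nonneg _).trans (hQ t ht')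
    have hS0 := (norm_nonneg _).trans (hS t ht')
    rw [Real.coe_toNNReal _ (le_max_of_le_left hP0)]
    have e : A t v = (p t * v.2, q t * v.2 + s t * v.1) := rfl
    rw [e, Prod.norm_mk]
    refine max_le ?_ ?_
    · rw [norm_mul]
      exact mul_le_mul ((hP t ht').trans (le_max_left _ _)) h2 (norm_nonneg _)
        (le_max_of_le_left hP0)
    · refine (norm_add_le _ _).trans ?_
      rw [norm_mul (q t), norm_mul (s t)]
      calc _ ≤ Q * ‖v‖ + S * ‖v‖ := add_le_add
            (mul_le_mul (hQ t ht') h2 (norm_nonneg _) hQ0)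
            (mul_le_mul (hS t ht') h1 (norm_nonneg _) hS0)
        _ = (Q + S) * ‖v‖ := by ring
        _ ≤ _ := mul_le_mul_of_nonneg_right (le_max_right _ _) (norm_nonneg _)
  have huniq := ODE_solution_unique_of_mem_Ioo (v := fun t => A t) (s := fun _ => Set.univ)
    (f := fun t => (f t, h t)) (g := fun _ => (0, 0)) (t₀ := Real.pi) hlip
    ⟨he1, by linarith⟩ (fun t ht => ⟨?_, trivial⟩) (fun t ht => ⟨?_, trivial⟩)
    (by simp [hf, hh])
  · have := huniq (x := θ) ⟨he2, by linarith⟩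
    exact congrArg Prod.fst this
  · have hd := H t (hsub (Set.Ioo_subset_Icc_self ht))
    refine (hd.1.prodMk hd.2).congr_deriv ?_
    change _ = (p t * h t, q t * h t + s t * f t)
    simp only [p, q, s]
    refine Prod.ext rfl ?_
    ring
  · refine (hasDerivAt_const t ((0 : ℂ), (0 : ℂ))).congr_deriv ?_
    exact ((A t).map_zero).symm

/-- Three initial vectors at `π` lie in `ℂ²`, hence are dependent, and uniqueness carries the
relation along the open arc. Continuity extends it to the endpoints, which is where the coefficients
will be read off. -/
lemma exists_circle_relation {a b c : ℂ} {f h : Fin 3 → ℝ → ℂ}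
    (H : ∀ i, IsCircleSolution a b c (f i) (h i)) (hf : ∀ i, Continuous (f i)) :
    ∃ g : Fin 3 → ℂ, g ≠ 0 ∧ ∀ θ ∈ Set.Icc 0 (2 * Real.pi), ∑ i, g i * f i θ = 0 := by
  have hdep : ¬ LinearIndependent ℂ fun i => (f i Real.pi, h i Real.pi) := fun hli => by
    have := hli.fintype_card_le_finrank
    simp at this
  obtain ⟨g, hg, i, hi⟩ := Fintype.not_linearIndependent_iff.mp hdep
  refine ⟨g, fun e => hi (by rw [e]; rfl), ?_⟩
  have h1 : ∑ i, g i * f i Real.pi = 0 := by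
    simpa [Prod.fst_sum] using congrArg Prod.fst hg
  have h2 : ∑ i, g i * h i Real.pi = 0 := by
    simpa [Prod.snd_sum] using congrArg Prod.snd hg
  have h3 : Set.EqOn (fun θ => ∑ i, g i * f i θ) (fun _ => 0)
      (closure (Set.Ioo 0 (2 * Real.pi))) :=
    Set.EqOn.closure (fun θ hθ => (IsCircleSolution.sum H g).eq_zero h1 h2 hθ)
      (continuous_finsetSum _ fun i _ => continuous_const.mul (hf i)) continuous_const
  rw [closure_Ioo Real.two_pi_pos.ne] at h3
  exact h3

end

end DeformedYangian

namespace DeformedYangian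

noncomputable section

open Filter Topology Complex

/-! ### The connection formula between `0` and `∞` on the unit circle -/

lemma sin_pi_mul_ne_zero {x : ℂ} (hx : ∀ k : ℤ, x ≠ k) : sin (Real.pi * x) ≠ 0 := by
  rw [Ne, Complex.sin_eq_zero_iff]
  rintro ⟨k, hk⟩
  refine hx k (mul_left_cancel₀ (ofReal_ne_zero.mpr Real.pi_ne_zero) ?_)
  rw [hk]; ring

lemma add_natCast_ne_zero_of_ne_int {x : ℂ} (hx : ∀ k : ℤ, x ≠ k) (k : ℕ) : x + k ≠ 0 :=
  fun h => hx (-k) (by push_cast; linear_combination h)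

lemma exp_sub_exp_neg (x : ℂ) : exp (I * x) - exp (-(I * x)) = 2 * I * sin x := by
  rw [Complex.sin, mul_comm I x, neg_mul]
  linear_combination (exp (x * I) - exp (-(x * I))) * I_sq

lemma circleSum_zero (t : ℕ → ℂ) : circleSum t 0 = ∑' n, t n := by simp [circleSum]

lemma circleSum_neg_two_pi (t : ℕ → ℂ) : circleSum t (-(2 * Real.pi)) = ∑' n, t n := by
  have : exp (I * ((-(2 * Real.pi) : ℝ) : ℂ)) = 1 := by
    rw [exp_eq_one_iff]; exact ⟨-1, by push_cast; ring⟩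
  simp only [circleSum, this, one_pow, mul_one]

lemma circleSum_two_pi (t : ℕ → ℂ) : circleSum t (2 * Real.pi) = ∑' n, t n := by
  have : exp (I * ((2 * Real.pi : ℝ) : ℂ)) = 1 := by
    rw [exp_eq_one_iff]; exact ⟨1, by push_cast; ring⟩
  simp only [circleSum, this, one_pow, mul_one]

/-- The relation among the three solutions is evaluated at `θ = 0` and `θ = 2π`. Gauss' theorem
gives the same three values `G0`, `G1`, `G2` at both ends; only the branch factors `e^{±iπa}`,
`e^{±iπb}` differ, so two independent equations determine the coefficients up to scale. -/
theorem hypergeometric_connection {a b c : ℂ} (h : 0 < (c - a - b).re)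
    (ha : ∀ k : ℤ, a ≠ k) (hb : ∀ k : ℤ, b ≠ k) (hc : ∀ k : ℤ, c ≠ k)
    (hba : ∀ k : ℤ, b - a ≠ k) (hca : ∀ k : ℤ, c - a ≠ k) (hcb : ∀ k : ℤ, c - b ≠ k)
    {θ : ℝ} (hθ : θ ∈ Set.Icc 0 (2 * Real.pi)) :
    sin (Real.pi * (b - a)) * (Gamma (c - a) * Gamma (c - b) / Gamma c) *
        circleSum (hypCoeff a b c) θ =
      sin (Real.pi * b) * (Gamma (1 - b) * Gamma (c - b) / Gamma (a - b + 1)) *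
          (exp (-(I * a * (θ - Real.pi))) *
            circleSum (hypCoeff a (a - c + 1) (a - b + 1)) (-θ)) -
        sin (Real.pi * a) * (Gamma (1 - a) * Gamma (c - a) / Gamma (b - a + 1)) *
          (exp (-(I * b * (θ - Real.pi))) *
            circleSum (hypCoeff b (b - c + 1) (b - a + 1)) (-θ)) := by
  have hc' := add_natCast_ne_zero_of_ne_int hc
  have hab1 : ∀ k : ℤ, a - b + 1 ≠ k := fun k e => hba (1 - k) (by push_cast; rw [← e]; ring)
  have hba1 : ∀ k : ℤ, b - a + 1 ≠ k := fun k e => hba (k - 1) (by push_cast; rw [← e]; ring)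
  have h1a : ∀ k : ℤ, 1 - a ≠ k := fun k e => ha (1 - k) (by push_cast; rw [← e]; ring)
  have h1b : ∀ k : ℤ, 1 - b ≠ k := fun k e => hb (1 - k) (by push_cast; rw [← e]; ring)
  have hab1' := add_natCast_ne_zero_of_ne_int hab1
  have hba1' := add_natCast_ne_zero_of_ne_int hba1
  have hs' : 0 < (c - b - a).re := by simp at h ⊢; linarith
  have hs1 : 0 < (a - b + 1 - a - (a - c + 1)).re := by simp at h ⊢; linarith
  have hs2 : 0 < (b - a + 1 - b - (b - c + 1)).re := by simp at h ⊢; linarith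
  have gΓ : ∀ {x : ℂ}, (∀ k : ℤ, x ≠ k) → Gamma x ≠ 0 := fun hx =>
    Gamma_ne_zero_of_add (add_natCast_ne_zero_of_ne_int hx)
  have hΓs : Gamma (c - a - b) ≠ 0 := Gamma_ne_zero_of_re_pos h
  obtain ⟨g, hg, hrel⟩ := exists_circle_relation (a := a) (b := b) (c := c)
    (f := ![circleSum (hypCoeff a b c),
      fun θ => exp (-(I * a * (θ - Real.pi))) *
        circleSum (hypCoeff a (a - c + 1) (a - b + 1)) (-θ),
      fun θ => exp (-(I * b * (θ - Real.pi))) *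
        circleSum (hypCoeff b (b - c + 1) (b - a + 1)) (-θ)])
    (h := ![_, _, _])
    (by
      intro i
      fin_cases i
      · exact isCircleSolution_hyp hc' h
      · exact isCircleSolution_inv hab1' h
      · exact (isCircleSolution_inv hba1' hs').comm)
    (by
      intro i
      fin_cases i
      · exact continuous_circleSum (summable_hypCoeff hc' h)
      · exact Continuous.mul (by fun_prop)
          ((continuous_circleSum (summable_hypCoeff hab1' hs1)).comp continuous_neg)
      · exact Continuous.mul (by fun_prop)
          ((continuous_circleSum (summable_hypCoeff hba1' hs2)).comp continuous_neg))
  have e0 := tsum_hypCoeff hc' h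
  have e1 := tsum_hypCoeff hab1' hs1
  have e2 := tsum_hypCoeff hba1' hs2
  rw [show a - b + 1 - a - (a - c + 1) = c - a - b by ring, show a - b + 1 - a = 1 - b by ring,
    show a - b + 1 - (a - c + 1) = c - b by ring] at e1
  rw [show b - a + 1 - b - (b - c + 1) = c - a - b by ring, show b - a + 1 - b = 1 - a by ring,
    show b - a + 1 - (b - c + 1) = c - a by ring] at e2
  have r0 := hrel 0 ⟨le_rfl, Real.two_pi_pos.le⟩
  have r1 := hrel (2 * Real.pi) ⟨Real.two_pi_pos.le, le_rfl⟩
  have r := hrel θ hθ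
  simp only [Fin.sum_univ_three, Matrix.cons_val_zero, Matrix.cons_val_one, Matrix.cons_val]
    at r0 r1 r
  rw [neg_zero, circleSum_zero, circleSum_zero, circleSum_zero, e0, e1, e2] at r0
  rw [circleSum_neg_two_pi, circleSum_neg_two_pi, circleSum_two_pi, e0, e1, e2] at r1
  have x1 : ∀ y : ℂ, -(I * y * (((0 : ℝ) : ℂ) - Real.pi)) = I * (Real.pi * y) := fun y => by
    push_cast; ring
  have x2 : ∀ y : ℂ, -(I * y * (((2 * Real.pi : ℝ) : ℂ) - Real.pi)) = -(I * (Real.pi * y)) :=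
    fun y => by push_cast; ring
  rw [x1, x1] at r0
  rw [x2, x2] at r1
  have sa := exp_sub_exp_neg (Real.pi * a)
  have sb := exp_sub_exp_neg (Real.pi * b)
  have sba := exp_sub_exp_neg (Real.pi * (b - a))
  have xba : exp (I * (Real.pi * (b - a))) =
      exp (I * (Real.pi * b)) * exp (-(I * (Real.pi * a))) := by
    rw [← exp_add]; congr 1; ring
  have xba' : exp (-(I * (Real.pi * (b - a)))) =
      exp (-(I * (Real.pi * b))) * exp (I * (Real.pi * a)) := by
    rw [← exp_add]; congr 1; ring
  rw [xba, xba'] at sba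
  have hsa := sin_pi_mul_ne_zero ha
  have h2I : (2 * I : ℂ) ≠ 0 := by simp
  have n0 := gΓ hc
  have n1 := gΓ hab1
  have n2 := gΓ hba1
  have n3 := gΓ hca
  have n4 := gΓ hcb
  have n5 := gΓ h1a
  have n6 := gΓ h1b
  set G0 := Gamma c * Gamma (c - a - b) / (Gamma (c - a) * Gamma (c - b)) with hG0
  set G1 := Gamma (a - b + 1) * Gamma (c - a - b) / (Gamma (1 - b) * Gamma (c - b)) with hG1
  set G2 := Gamma (b - a + 1) * Gamma (c - a - b) / (Gamma (1 - a) * Gamma (c - a)) with hG2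
  have m0 : G0 ≠ 0 := by positivity
  have m1 : G1 ≠ 0 := by positivity
  have m2 : G2 ≠ 0 := by positivity
  set A := exp (I * (Real.pi * a))
  set A' := exp (-(I * (Real.pi * a)))
  set B := exp (I * (Real.pi * b))
  set B' := exp (-(I * (Real.pi * b)))
  -- Eliminating `g 1` from the two endpoint equations gives `k0`; subtracting them gives `k1`.
  have k0 : g 0 * G0 * sin (Real.pi * a) = g 2 * G2 * sin (Real.pi * (b - a)) := by
    apply mul_left_cancel₀ h2I
    linear_combination (-A') * r0 + A * r1 - g 0 * G0 * sa + g 2 * G2 * sba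
  have k1 : g 1 * G1 * sin (Real.pi * a) = -(g 2 * G2 * sin (Real.pi * b)) := by
    apply mul_left_cancel₀ h2I
    linear_combination r0 - r1 - g 1 * G1 * sa - g 2 * G2 * sb
  -- If `g 2` vanished, `k0` and `k1` would kill the other two coefficients as well, since `sin (π
  -- a)` is nonzero.
  have hg2 : g 2 ≠ 0 := fun e => by
    rw [e] at k0 k1
    simp only [zero_mul, neg_zero, mul_eq_zero, m0, m1, hsa, or_false] at k0 k1
    exact hg (funext fun i => by fin_cases i <;> assumption)
  generalize circleSum (hypCoeff a b c) θ = f0 at r ⊢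
  generalize exp (-(I * a * (θ - Real.pi))) *
    circleSum (hypCoeff a (a - c + 1) (a - b + 1)) (-θ) = f1 at r ⊢
  generalize exp (-(I * b * (θ - Real.pi))) *
    circleSum (hypCoeff b (b - c + 1) (b - a + 1)) (-θ) = f2 at r ⊢
  have i0 : Gamma (c - a) * Gamma (c - b) / Gamma c = Gamma (c - a - b) / G0 := by
    rw [hG0]; field_simp
  have i1 : Gamma (1 - b) * Gamma (c - b) / Gamma (a - b + 1) = Gamma (c - a - b) / G1 := by
    rw [hG1]; field_simp
  have i2 : Gamma (1 - a) * Gamma (c - a) / Gamma (b - a + 1) = Gamma (c - a - b) / G2 := by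
    rw [hG2]; field_simp
  rw [i0, i1, i2]
  clear_value G0 G1 G2
  field_simp
  apply mul_left_cancel₀ hg2
  linear_combination (-(f0 * G1)) * k0 - f1 * G0 * k1 + (G0 * G1 * sin (Real.pi * a)) * r

end

end DeformedYangian

namespace DeformedYangian

noncomputable section

open Filter Topology Complex

/-! ### Contiguous relations -/

/-- The relation holds coefficient by coefficient, through `(c - a)(c + a + n) = c (c + n) - a (a +
n)`; this is where the special shape `b = c + a` of the twist parameters enters. -/
lemma tsum_contiguous_lower {a b c z : ℂ} (hc : ∀ k : ℕ, c + k ≠ 0) (ha : a ≠ 0) (hb : b ≠ 0)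
    (h : 0 < (c - a - b).re) (hz : ‖z‖ = 1) (hbca : b = c + a) :
    (c - a) * b * ∑' n, hypCoeff a (b + 1) (c + 1) n * z ^ n =
      c ^ 2 * ∑' n, hypCoeff a b c n * z ^ n -
        a ^ 2 * ∑' n, hypCoeff (a + 1) b (c + 1) n * z ^ n := by
  have hc1 : ∀ k : ℕ, c + 1 + k ≠ 0 := by simpa using add_natCast_ne_zero hc 1
  have s0 := summable_hypCoeff_mul_pow hc h hz
  have s1 := summable_hypCoeff_mul_pow (a := a + 1) (b := b) (z := z) hc1
    (by simp at h ⊢; linarith) hz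
  rw [← tsum_mul_left, ← tsum_mul_left, ← tsum_mul_left,
    ← (s0.mul_left _).tsum_sub (s1.mul_left _)]
  refine tsum_congr fun n => ?_
  have e1 : c * poch (c + 1) n = poch c n * (c + n) := by rw [← poch_succ, ← poch_succ_left]
  have e2 : a * poch (a + 1) n = poch a n * (a + n) := by rw [← poch_succ, ← poch_succ_left]
  have e3 : b * poch (b + 1) n = poch b n * (b + n) := by rw [← poch_succ, ← poch_succ_left]
  have h0 : c ≠ 0 := by simpa using hc 0
  have p1 := poch_ne_zero hc1 n
  have p0 := poch_ne_zero hc n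
  have hn := hc n
  have hf : (n.factorial : ℂ) ≠ 0 := Nat.cast_ne_zero.mpr n.factorial_ne_zero
  have e1' : poch (c + 1) n = poch c n * (c + n) / c := by rw [← e1]; field_simp
  have e2' : poch (a + 1) n = poch a n * (a + n) / a := by rw [← e2]; field_simp
  have e3' : poch (b + 1) n = poch b n * (b + n) / b := by rw [← e3]; field_simp
  simp only [hypCoeff, e1', e2', e3']
  field_simp
  rw [hbca]
  ring

/-- The constant terms on the right cancel; reindexing the rest by one produces the factor `z` and
raises all parameters. -/
lemma tsum_contiguous_raise {a b c z : ℂ} (hc : ∀ k : ℕ, c + k ≠ 0)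
    (h : 0 < (c - a - b).re) (hz : ‖z‖ = 1) :
    (c - a) * b / (c * (c + 1)) * (z * ∑' n, hypCoeff (a + 1) (b + 1) (c + 2) n * z ^ n) =
      ∑' n, hypCoeff (a + 1) b (c + 1) n * z ^ n - ∑' n, hypCoeff a b c n * z ^ n := by
  have hc1 : ∀ k : ℕ, c + 1 + k ≠ 0 := by simpa using add_natCast_ne_zero hc 1
  have hc2 : ∀ k : ℕ, c + 2 + k ≠ 0 := by simpa using add_natCast_ne_zero hc 2
  have s0 := summable_hypCoeff_mul_pow hc h hz
  have s1 := summable_hypCoeff_mul_pow (a := a + 1) (b := b) (z := z) hc1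
    (by simp at h ⊢; linarith) hz
  rw [← s1.tsum_sub s0, (s1.sub s0).tsum_eq_zero_add]
  simp only [hypCoeff_zero, sub_self, zero_add]
  rw [← tsum_mul_left, ← tsum_mul_left]
  refine tsum_congr fun n => ?_
  have h0 : c ≠ 0 := by simpa using hc 0
  have h1 : c + 1 ≠ 0 := by simpa using hc 1
  have hf : (n.factorial : ℂ) ≠ 0 := Nat.cast_ne_zero.mpr n.factorial_ne_zero
  have hn1 : (n : ℂ) + 1 ≠ 0 := Nat.cast_add_one_ne_zero n
  have q1 : poch (c + 1) (n + 1) = (c + 1) * poch (c + 2) n := by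
    rw [poch_succ_left]; ring_nf
  have q2 : poch (c + 1) (n + 1) = poch (c + 1) n * (c + 1 + n) := poch_succ _ _
  have q3 : poch c (n + 1) = c * poch (c + 1) n := poch_succ_left _ _
  have q4 : poch (a + 1) (n + 1) = poch (a + 1) n * (a + 1 + n) := poch_succ _ _
  have p2 := poch_ne_zero hc2 n
  have p1 := poch_ne_zero hc1 n
  have hn := hc1 n
  have q5 : poch (c + 2) n = poch (c + 1) n * (c + 1 + n) / (c + 1) := by
    rw [← q2, q1]; field_simp
  simp only [hypCoeff, Nat.factorial_succ]
  rw [q2, q3, q4, q5, poch_succ_left a, poch_succ_left b]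
  push_cast
  field_simp
  ring

lemma Regular.add {r u : ℂ} (h : Regular r u) : Regular r (u + r) := fun k => by
  obtain ⟨h1, h2, h3⟩ := h (k + 1)
  push_cast at h1 h2 h3
  refine ⟨fun e => h1 ?_, fun e => h2 ?_, fun e => h3 ?_⟩ <;> linear_combination e

/-! ### Difference equations in `u` for the entries of the twist -/

section parameters

variable {r u : ℂ}

lemma Regular.c_add_ne (h : Regular r u) (hr0 : r ≠ 0) (k : ℕ) : u / r + 1 + k ≠ 0 := fun e =>
  (h k).1 (by field_simp at e; linear_combination e)

lemma Regular.b_add_ne (h : Regular r u) (hr0 : r ≠ 0) (k : ℕ) : (u - 1) / r + 1 + k ≠ 0 :=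
  fun e => (h k).2.1 (by field_simp at e; linear_combination e)

lemma re_one_div_pos (hr : 0 < r.re) : 0 < (1 / r).re := by
  rw [one_div, inv_re]
  exact div_pos hr (normSq_pos.mpr fun e => by simp [e] at hr)

lemma ne_zero_of_re_pos (hr : 0 < r.re) : r ≠ 0 := fun e => by simp [e] at hr

lemma parameter_excess_pos (hr : 0 < r.re) :
    0 < (u / r + 1 - -1 / r - ((u - 1) / r + 1)).re := by
  have h0 := ne_zero_of_re_pos hr
  rw [show u / r + 1 - -1 / r - ((u - 1) / r + 1) = 1 / r + 1 / r by field_simp; ring, add_re]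
  have := re_one_div_pos hr
  linarith

/-- With `a = -1/r`, `b = (u-1)/r + 1`, `c = u/r + 1`, the shift by `r` raises `b` and `c` by one,
and `b = c + a`; so this is `tsum_contiguous_lower` with the Gamma prefactors restored. `cFun_add`
is `tsum_contiguous_raise` in the same way. -/
theorem bFun_add {z : ℂ} (hr : 0 < r.re) (h : Regular r u) (hz : ‖z‖ = 1) :
    (u + r + 1) * bFun r z (u + r) = (u + r) * bFun r z u + z⁻¹ * cFun r z u := by
  have hr0 := ne_zero_of_re_pos hr
  have hz0 : z ≠ 0 := norm_ne_zero_iff.mp (by rw [hz]; exact one_ne_zero)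
  have hb0 : (u - 1) / r + 1 ≠ 0 := by simpa using h.b_add_ne hr0 0
  have hc0 : u / r + 1 ≠ 0 := by simpa using h.c_add_ne hr0 0
  have key := tsum_contiguous_lower (h.c_add_ne hr0) (a := -1 / r) (by simp [hr0]) hb0
    (parameter_excess_pos hr) hz (by field_simp; ring)
  simp only [bFun, cFun, ordinaryHypergeometric_eq]
  rw [show (u + r - 1) / r + 1 = (u - 1) / r + 1 + 1 by field_simp; ring,
    show (u + r) / r + 1 = u / r + 1 + 1 by field_simp,
    show u / r + 2 = u / r + 1 + 1 by ring, Gamma_add_one _ hb0, Gamma_add_one _ hc0]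
  have g := Gamma_ne_zero_of_add (h.c_add_ne hr0)
  have ec : u + r = r * (u / r + 1) := by field_simp
  have ea : u + r + 1 = r * (u / r + 1 - -1 / r) := by field_simp; ring
  have hi : -1 / r * r = -1 := by field_simp
  rw [ea, ec]
  generalize (u - 1) / r + 1 = b at *
  generalize u / r + 1 = c at *
  generalize hA : -1 / r = a at *
  have hra : r⁻¹ = -a := by rw [← hA]; ring
  generalize (∑' n, hypCoeff a (b + 1) (c + 1) n * z ^ n) = S2 at *
  generalize (∑' n, hypCoeff (a + 1) b (c + 1) n * z ^ n) = S1 at *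
  generalize (∑' n, hypCoeff a b c n * z ^ n) = S0 at *
  rw [div_eq_mul_inv z r, hra]
  field_simp
  linear_combination (r * Gamma b) * key - a * S1 * Gamma b * hi

theorem cFun_add {z : ℂ} (hr : 0 < r.re) (h : Regular r u) (hz : ‖z‖ = 1) :
    (u + r + 1) * cFun r z (u + r) = bFun r z u + (u + r) * (z⁻¹ * cFun r z u) := by
  have hr0 := ne_zero_of_re_pos hr
  have hz0 : z ≠ 0 := norm_ne_zero_iff.mp (by rw [hz]; exact one_ne_zero)
  have hb0 : (u - 1) / r + 1 ≠ 0 := by simpa using h.b_add_ne hr0 0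
  have hc0 : u / r + 1 ≠ 0 := by simpa using h.c_add_ne hr0 0
  have hc1 : u / r + 1 + 1 ≠ 0 := by simpa using h.c_add_ne hr0 1
  have key := tsum_contiguous_raise (h.c_add_ne hr0) (a := -1 / r)
    (parameter_excess_pos hr) hz
  simp only [bFun, cFun, ordinaryHypergeometric_eq]
  rw [show (u + r - 1) / r + 1 = (u - 1) / r + 1 + 1 by field_simp; ring,
    show (u + r) / r + 2 = u / r + 1 + 2 by field_simp,
    show u / r + 1 + 2 = u / r + 1 + 1 + 1 by ring,
    show u / r + 2 = u / r + 1 + 1 by ring, Gamma_add_one _ hb0, Gamma_add_one _ hc1,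
    Gamma_add_one _ hc0]
  rw [show u / r + 1 + 2 = u / r + 1 + 1 + 1 by ring] at key
  have g := Gamma_ne_zero_of_add (h.c_add_ne hr0)
  have ec : u + r = r * (u / r + 1) := by field_simp
  have ea : u + r + 1 = r * (u / r + 1 - -1 / r) := by field_simp; ring
  rw [ea, ec]
  generalize (u - 1) / r + 1 = b at *
  generalize u / r + 1 = c at *
  generalize -1 / r = a at *
  generalize (∑' n, hypCoeff (a + 1) (b + 1) (c + 1 + 1) n * z ^ n) = S2 at *
  generalize (∑' n, hypCoeff (a + 1) b (c + 1) n * z ^ n) = S1 at *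
  generalize (∑' n, hypCoeff a b c n * z ^ n) = S0 at *
  field_simp at key ⊢
  linear_combination (-Gamma b) * key

/-! ### Non-degeneracy of the twist -/

/-- The determinant of a `2 × 2` block of the twist. -/
def twistDet (r z u : ℂ) : ℂ := bFun r z u * bFun r z⁻¹ u - cFun r z u * cFun r z⁻¹ u

/-- The determinant of the `2 × 2` shift relation: the matrix with entries `u + r` and `1`
contributes `(u + r)² - 1`, and the factors `z^{±1}` cancel. -/
lemma twistDet_add {z : ℂ} (hr : 0 < r.re) (h : Regular r u) (hz : ‖z‖ = 1) :
    (u + r + 1) ^ 2 * twistDet r z (u + r) = ((u + r) ^ 2 - 1) * twistDet r z u := by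
  have hz0 : z ≠ 0 := norm_ne_zero_iff.mp (by rw [hz]; exact one_ne_zero)
  have hz' : ‖z⁻¹‖ = 1 := by rw [norm_inv, hz, inv_one]
  have b1 := bFun_add hr h hz
  have b2 := bFun_add hr h hz'
  have c1 := cFun_add hr h hz
  have c2 := cFun_add hr h hz'
  rw [inv_inv] at b2 c2
  have e : (u + r + 1) ^ 2 * twistDet r z (u + r) =
      ((u + r + 1) * bFun r z (u + r)) * ((u + r + 1) * bFun r z⁻¹ (u + r)) -
      ((u + r + 1) * cFun r z (u + r)) * ((u + r + 1) * cFun r z⁻¹ (u + r)) := by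
    rw [twistDet]; ring
  rw [e, b1, b2, c1, c2, twistDet]
  field_simp
  ring

/-! ### Limits of the twist entries along `u + m r`, `m → ∞` -/

lemma tendsto_poch_ratio (b c : ℂ) (n : ℕ) :
    Tendsto (fun m : ℕ => poch (b + m) n / poch (c + m) n) atTop (𝓝 1) := by
  induction n with
  | zero => simp
  | succ n ih =>
    have h1 := tendsto_add_mul_div_add_mul_atTop_nhds (b + n) (c + n) 1 (one_ne_zero (α := ℂ))
    have h2 := ih.mul h1
    rw [div_one, mul_one] at h2
    refine h2.congr fun m => ?_
    rw [poch_succ, poch_succ, div_mul_div_comm]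
    congr 2 <;> ring

/-- The difference of squares is `|c|² - |b|² + 2 (m + j) Re (c - b)`, so a large `m` works for all
`j` at once. This makes the Pochhammer ratios at most `1` uniformly in the index, as dominated
convergence requires. -/
lemma eventually_norm_add_le {b c : ℂ} (h : 0 < (c - b).re) :
    ∀ᶠ m : ℕ in atTop, ∀ j : ℕ, ‖b + m + j‖ ≤ ‖c + m + j‖ := by
  obtain ⟨M, hM⟩ := exists_nat_ge ((‖b‖ ^ 2 - ‖c‖ ^ 2) / (2 * (c - b).re))
  rw [div_le_iff₀ (by linarith)] at hM
  filter_upwards [eventually_ge_atTop M] with m hm j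
  have hm' : (M : ℝ) ≤ m + j := by
    have : (M : ℝ) ≤ m := by exact_mod_cast hm
    have hj : (0 : ℝ) ≤ j := Nat.cast_nonneg j
    linarith
  rw [← sq_le_sq₀ (norm_nonneg _) (norm_nonneg _)]
  rw [Complex.sq_norm, Complex.sq_norm, normSq_apply, normSq_apply] at hM ⊢
  simp only [add_re, natCast_re, add_im, natCast_im, add_zero, sub_re] at hM h ⊢
  nlinarith [mul_nonneg (sub_nonneg.mpr hm') h.le]

/-- The ratio `(b+m)_n / (c+m)_n` tends to `1` with norm at most `1`, so the limit is the binomial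
series, absolutely convergent because `Re a < 0`. -/
lemma tendsto_tsum_hypCoeff_binomial {a b c z : ℂ} (hc : ∀ k : ℕ, c + k ≠ 0) (ha : a.re < 0)
    (h : 0 < (c - b).re) (hz : ‖z‖ = 1) :
    Tendsto (fun m : ℕ => ∑' n, hypCoeff a (b + m) (c + m) n * z ^ n) atTop
      (𝓝 (∑' n, hypCoeff a 1 1 n * z ^ n)) := by
  have h1 : ∀ k : ℕ, (1 : ℂ) + k ≠ 0 := fun k => by
    rw [add_comm]; exact Nat.cast_add_one_ne_zero k
  have e : ∀ b c n, hypCoeff a b c n = poch a n / n.factorial * (poch b n / poch c n) :=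
    fun b c n => by rw [hypCoeff, div_mul_div_comm, mul_comm (poch c n)]
  have e1 : ∀ n, hypCoeff a 1 1 n = poch a n / n.factorial := fun n => by
    rw [e, div_self (poch_ne_zero h1 n), mul_one]
  refine tendsto_tsum_of_dominated_convergence
    (summable_hypCoeff (a := a) (b := 1) h1 (by simpa using ha)) (fun n => ?_) ?_
  · refine Tendsto.mul_const _ ?_
    simp only [e _ _ n, div_self (poch_ne_zero h1 n)]
    exact (tendsto_poch_ratio b c n).const_mul _
  · filter_upwards [eventually_norm_add_le h] with m hm n
    have hp := norm_pos_iff.mpr (poch_ne_zero (add_natCast_ne_zero hc m) n)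
    rw [norm_mul, norm_pow, hz, one_pow, mul_one, e1, e, norm_mul]
    refine mul_le_of_le_one_right (norm_nonneg _) ?_
    rw [norm_div]
    exact div_le_one_of_le₀ (norm_poch_le hm n) hp.le

/-- With first parameter `a + 1` the binomial series may fail to converge absolutely. The divisor `c
+ m` repairs this: `(c+m)(c+m+1)_n = (c+m)_n (c+m+n)`, so each term gains `1/(c+m+n)`, which tends
to `0` and is eventually bounded by `1/(n+1)`. The majorant is then the series with parameters `a +
1, 1; 2`. -/
lemma tendsto_tsum_hypCoeff_div {a b c z : ℂ} (hc : ∀ k : ℕ, c + k ≠ 0) (ha : a.re < 0)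
    (h : 0 < (c - b).re) (hz : ‖z‖ = 1) :
    Tendsto (fun m : ℕ => (∑' n, hypCoeff (a + 1) (b + m) (c + m + 1) n * z ^ n) / (c + m)) atTop
      (𝓝 0) := by
  have h1 : ∀ k : ℕ, (1 : ℂ) + k ≠ 0 := fun k => by
    rw [add_comm]; exact Nat.cast_add_one_ne_zero k
  have h2 : ∀ k : ℕ, (2 : ℂ) + k ≠ 0 := fun k => by exact_mod_cast (by omega : 2 + k ≠ 0)
  have e2 : ∀ n, hypCoeff (a + 1) 1 2 n = poch (a + 1) n / n.factorial * ((n : ℂ) + 1)⁻¹ := by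
    intro n
    have q : poch 2 n = poch 1 n * (1 + n) := by
      rw [← poch_succ, poch_succ_left, one_mul]; norm_num
    have := h1 n
    have := poch_ne_zero h1 n
    rw [hypCoeff, q, add_comm (n : ℂ)]
    field_simp
  have e : ∀ (m n : ℕ), hypCoeff (a + 1) (b + m) (c + m + 1) n * z ^ n / (c + m) =
      poch (a + 1) n / n.factorial * (poch (b + m) n / poch (c + m) n) * (c + m + n)⁻¹ *
        z ^ n := by
    intro m n
    have hm := add_natCast_ne_zero hc m
    have hcm := hc m
    have q : poch (c + m + 1) n = poch (c + m) n * (c + m + n) / (c + m) := by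
      rw [← poch_succ, poch_succ_left]; field_simp
    have := hm n
    have := poch_ne_zero hm n
    rw [hypCoeff, q]
    field_simp
  have e0 : (0 : ℂ) = ∑' _ : ℕ, (0 : ℂ) := by simp
  rw [e0]
  simp only [← tsum_div_const]
  refine tendsto_tsum_of_dominated_convergence
    (summable_hypCoeff (a := a + 1) (b := 1) h2 (by simp; linarith)) (fun n => ?_) ?_
  · simp only [e]
    have t1 : Tendsto (fun m : ℕ => (c + m + n)⁻¹) atTop (𝓝 0) := by
      rw [tendsto_zero_iff_norm_tendsto_zero]
      refine (tendsto_norm_add_natCast (c + n)).inv_tendsto_atTop.congr fun m => ?_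
      rw [Pi.inv_apply, norm_inv]; congr 2; ring
    simpa using ((((tendsto_poch_ratio b c n).const_mul
      (poch (a + 1) n / n.factorial)).mul t1).mul_const (z ^ n))
  · obtain ⟨M, hM⟩ := exists_nat_ge (1 - c.re)
    filter_upwards [eventually_norm_add_le h, eventually_ge_atTop M] with m hm hMm n
    have hp := norm_pos_iff.mpr (poch_ne_zero (add_natCast_ne_zero hc m) n)
    have hM' : 1 - c.re ≤ m := hM.trans (by exact_mod_cast hMm)
    rw [e, norm_mul _ (z ^ n), norm_pow, hz, one_pow, mul_one, e2, norm_mul, norm_mul, norm_mul]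
    have i1 : ‖poch (b + m) n / poch (c + m) n‖ ≤ 1 := by
      rw [norm_div]
      exact div_le_one_of_le₀ (norm_poch_le hm n) hp.le
    have i2 : ‖(c + m + n)⁻¹‖ ≤ ‖((n : ℂ) + 1)⁻¹‖ := by
      rw [norm_inv, norm_inv]
      have e3 : ‖(n : ℂ) + 1‖ = n + 1 := by exact_mod_cast norm_natCast (n + 1)
      rw [e3]
      have := (re_le_norm (c + m + n))
      simp only [add_re, natCast_re] at this
      have hn : (0 : ℝ) ≤ n := Nat.cast_nonneg n
      exact inv_anti₀ (by linarith) (by linarith)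
    exact mul_le_mul (mul_le_of_le_one_right (norm_nonneg _) i1) i2 (norm_nonneg _)
      (norm_nonneg _)

lemma tsum_binomial_of_norm_lt_one (a : ℂ) {z : ℂ} (hz : ‖z‖ < 1) :
    ∑' n, hypCoeff a 1 1 n * z ^ n = (1 - z) ^ (-a) := by
  have h := (one_add_cpow_hasFPowerSeriesOnBall_zero (a := -a)).hasSum (y := -z)
    (by simpa [enorm_eq_nnnorm, ← NNReal.coe_lt_coe] using hz)
  rw [binomialSeries_eq_ordinaryHypergeometricSeries (b := 1)
    (fun k e => by
      have : (k : ℂ) + 1 = 0 := by rw [e]; ring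
      exact Nat.cast_add_one_ne_zero k this)] at h
  have h2 := h.tsum_eq
  rw [zero_add, ← sub_eq_add_neg] at h2
  rw [← h2, ← ordinaryHypergeometric_eq, ordinaryHypergeometric_eq_tsum]
  refine tsum_congr fun n => ?_
  rw [FormalMultilinearSeries.compContinuousLinearMap_apply]
  have : ((-ContinuousLinearMap.id ℂ ℂ : ℂ →L[ℂ] ℂ) ∘ fun _ : Fin n => -z) = fun _ => z := by
    funext i; simp
  rw [this, ordinaryHypergeometricSeries_apply_eq, neg_neg]

/-- An Abel limit along the radii `1 - 1/(m+1)` identifies the sum with `(1 - z)^{-a}`. Since `Re (1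
- z) > 0` on the circle away from `1`, the principal power is continuous there and does not vanish.
-/
lemma tsum_binomial_ne_zero {a z : ℂ} (ha : a.re < 0) (hz : ‖z‖ = 1) (hz1 : z ≠ 1) :
    ∑' n, hypCoeff a 1 1 n * z ^ n ≠ 0 := by
  have h1 : ∀ k : ℕ, (1 : ℂ) + k ≠ 0 := fun k => by
    rw [add_comm]; exact Nat.cast_add_one_ne_zero k
  have hs := summable_hypCoeff (a := a) (b := 1) h1 (by simpa using ha)
  have hre : 0 < (1 - z).re := by
    have h2 : z.re < 1 := by
      refine lt_of_le_of_ne (hz ▸ re_le_norm z) fun e => hz1 ?_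
      have h3 := Complex.sq_norm z
      rw [hz, normSq_apply, e] at h3
      have h4 : z.im = 0 := by nlinarith [mul_self_nonneg z.im]
      exact Complex.ext (by simpa using e) (by simpa using h4)
    simpa using h2
  have hlim1 : Tendsto (fun m : ℕ => ∑' n, hypCoeff a 1 1 n * ((1 - 1 / ((m : ℂ) + 1)) * z) ^ n)
      atTop (𝓝 (∑' n, hypCoeff a 1 1 n * z ^ n)) := by
    have hm : Tendsto (fun m : ℕ => (1 - 1 / ((m : ℂ) + 1)) * z) atTop (𝓝 z) := by
      simpa using ((tendsto_one_div_add_atTop_nhds_zero_nat (𝕜 := ℂ)).const_sub 1).mul_const z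
    refine tendsto_tsum_of_dominated_convergence hs (fun n => (hm.pow n).const_mul _) ?_
    filter_upwards with m n
    have e : (1 - 1 / ((m : ℂ) + 1)) = ((1 - 1 / ((m : ℝ) + 1) : ℝ) : ℂ) := by push_cast; rfl
    have hm1 : 1 / ((m : ℝ) + 1) ≤ 1 := by
      rw [div_le_one (by positivity)]; linarith [(Nat.cast_nonneg m : (0 : ℝ) ≤ m)]
    have hm2 : 0 < 1 / ((m : ℝ) + 1) := by positivity
    rw [norm_mul, norm_pow, norm_mul, hz, mul_one, e, norm_real,
      Real.norm_of_nonneg (by linarith)]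
    exact mul_le_of_le_one_right (norm_nonneg _) (pow_le_one₀ (by linarith) (by linarith))
  have hlim2 : Tendsto (fun m : ℕ => (1 - (1 - 1 / ((m : ℂ) + 1)) * z) ^ (-a))
      atTop (𝓝 ((1 - z) ^ (-a))) := by
    have hm : Tendsto (fun m : ℕ => 1 - (1 - 1 / ((m : ℂ) + 1)) * z) atTop (𝓝 (1 - z)) := by
      simpa using (((tendsto_one_div_add_atTop_nhds_zero_nat (𝕜 := ℂ)).const_sub 1).mul_const
        z).const_sub 1
    exact hm.cpow tendsto_const_nhds (Or.inl hre)
  have heq : ∑' n, hypCoeff a 1 1 n * z ^ n = (1 - z) ^ (-a) := by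
    refine tendsto_nhds_unique (hlim1.congr fun m => tsum_binomial_of_norm_lt_one a ?_) hlim2
    have e : (1 - 1 / ((m : ℂ) + 1)) = ((1 - 1 / ((m : ℝ) + 1) : ℝ) : ℂ) := by push_cast; rfl
    have hm1 : 1 / ((m : ℝ) + 1) ≤ 1 := by
      rw [div_le_one (by positivity)]; linarith [(Nat.cast_nonneg m : (0 : ℝ) ≤ m)]
    have hm2 : 0 < 1 / ((m : ℝ) + 1) := by positivity
    rw [norm_mul, hz, mul_one, e, norm_real, Real.norm_of_nonneg (by linarith)]
    linarith
  rw [heq, Ne, cpow_eq_zero_iff]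
  exact fun h => by simp [h.1] at hre

theorem twistDet_ne_zero {z : ℂ} (hr : 0 < r.re) (h : Regular r u) (hz : ‖z‖ = 1)
    (hz1 : z ≠ 1) : twistDet r z u ≠ 0 := by
  intro h0
  have hr0 := ne_zero_of_re_pos hr
  have hz0 : z ≠ 0 := norm_ne_zero_iff.mp (by rw [hz]; exact one_ne_zero)
  have hz' : ‖z⁻¹‖ = 1 := by rw [norm_inv, hz, inv_one]
  have hz1' : z⁻¹ ≠ 1 := fun e => hz1 (inv_eq_one.mp e)
  -- The recurrence only carries a zero forward because its left coefficient `(u + r + 1)²` is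
  -- nonzero; the right one may vanish.
  have hall : ∀ m : ℕ, Regular r (u + m * r) ∧ twistDet r z (u + m * r) = 0 := by
    intro m
    induction m with
    | zero => simpa using ⟨h, h0⟩
    | succ m ih =>
      have e : u + (m + 1 : ℕ) * r = u + m * r + r := by push_cast; ring
      rw [e]
      refine ⟨ih.1.add, ?_⟩
      have h1 := twistDet_add hr ih.1 hz
      rw [ih.2, mul_zero] at h1
      have h2 := (ih.1 0).2.2
      refine (mul_eq_zero.mp h1).resolve_left (pow_ne_zero 2 fun e => h2 ?_)
      push_cast; linear_combination e
  have ha : (-1 / r).re < 0 := by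
    have := re_one_div_pos hr
    rw [neg_div, neg_re]; linarith
  have hcb : 0 < (u / r + 1 - ((u - 1) / r + 1)).re := by
    rw [show u / r + 1 - ((u - 1) / r + 1) = 1 / r by field_simp; ring]
    exact re_one_div_pos hr
  have hc := h.c_add_ne hr0
  set b := (u - 1) / r + 1 with hb_def
  set c := u / r + 1 with hc_def
  have hbm : ∀ (w : ℂ) (m : ℕ), bFun r w (u + m * r) =
      Gamma (b + m) / Gamma (c + m) * ∑' n, hypCoeff (-1 / r) (b + m) (c + m) n * w ^ n := by
    intro w m
    rw [bFun, ordinaryHypergeometric_eq,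
      show (u + m * r - 1) / r + 1 = b + m by rw [hb_def]; field_simp; ring,
      show (u + m * r) / r + 1 = c + m by rw [hc_def]; field_simp; ring]
  have hcm : ∀ (w : ℂ) (m : ℕ), cFun r w (u + m * r) =
      Gamma (b + m) / Gamma (c + m) * (-(w / r) *
        ((∑' n, hypCoeff (-1 / r + 1) (b + m) (c + m + 1) n * w ^ n) / (c + m))) := by
    intro w m
    rw [cFun, ordinaryHypergeometric_eq,
      show (u + m * r - 1) / r + 1 = b + m by rw [hb_def]; field_simp; ring,
      show (u + m * r) / r + 2 = c + m + 1 by rw [hc_def]; field_simp; ring,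
      Gamma_add_one _ (hc m)]
    have := hc m
    have := Gamma_ne_zero_of_add (add_natCast_ne_zero hc m)
    field_simp
  -- Once the common factor `(Γ(b+m)/Γ(c+m))²` is removed, the product of the `c` entries disappears
  -- in the limit and the product of two binomial series remains.
  have hlim := ((tendsto_tsum_hypCoeff_binomial hc ha hcb hz).mul
    (tendsto_tsum_hypCoeff_binomial hc ha hcb hz')).sub
    (((tendsto_tsum_hypCoeff_div hc ha hcb hz).const_mul (-(z / r))).mul
      ((tendsto_tsum_hypCoeff_div hc ha hcb hz').const_mul (-(z⁻¹ / r))))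
  rw [mul_zero, mul_zero, mul_zero, sub_zero] at hlim
  refine mul_ne_zero (tsum_binomial_ne_zero ha hz hz1) (tsum_binomial_ne_zero ha hz' hz1')
    (tendsto_nhds_unique hlim (tendsto_const_nhds.congr fun m => ?_))
  have g : Gamma (b + m) / Gamma (c + m) ≠ 0 := div_ne_zero
    (Gamma_ne_zero_of_add (add_natCast_ne_zero (h.b_add_ne hr0) m))
    (Gamma_ne_zero_of_add (add_natCast_ne_zero hc m))
  have h2 := (hall m).2
  rw [twistDet, hbm, hbm, hcm, hcm] at h2
  apply mul_left_cancel₀ (mul_ne_zero g g)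
  rw [mul_zero]
  linear_combination -h2

end parameters

end

end DeformedYangian

namespace DeformedYangian

noncomputable section

open Filter Topology Complex

/-! ### The connection formula for the entries of the twist -/

lemma ordinaryHypergeometric_circle (a b c : ℂ) (θ : ℝ) :
    ordinaryHypergeometric a b c (exp (I * θ)) = circleSum (hypCoeff a b c) θ :=
  ordinaryHypergeometric_eq a b c _

lemma ordinaryHypergeometric_circle_inv (a b c : ℂ) (θ : ℝ) :
    ordinaryHypergeometric a b c (exp (I * θ))⁻¹ = circleSum (hypCoeff a b c) (-θ) := by
  rw [← ordinaryHypergeometric_circle, ← exp_neg]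
  push_cast
  rw [mul_neg]

lemma exp_I_mul_sub_pi (θ : ℝ) : exp (I * (θ - Real.pi)) = -exp (I * θ) := by
  rw [mul_sub, exp_sub, mul_comm I (Real.pi : ℂ), exp_pi_mul_I, div_neg, div_one]

section

variable {r u : ℂ}

/-- The non-integrality conditions on `u / r` and `1 / r` equivalent to genericity. -/
lemma Generic.ne_int (hr0 : r ≠ 0) (h : Generic r u) (k : ℤ) :
    u / r ≠ k ∧ (u + 1) / r ≠ k ∧ (u - 1) / r ≠ k := by
  obtain ⟨h1, h2, h3⟩ := h k
  exact ⟨fun e => h1 ((div_eq_iff hr0).mp e), fun e => h2 ((div_eq_iff hr0).mp e),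
    fun e => h3 ((div_eq_iff hr0).mp e)⟩

lemma Gamma_reflect {x : ℂ} (hx : ∀ k : ℤ, x ≠ k) :
    sin (Real.pi * x) * (Gamma x * Gamma (1 - x)) = Real.pi := by
  rw [Complex.Gamma_mul_Gamma_one_sub]
  field_simp [sin_pi_mul_ne_zero hx]

/-- With `x = u/r`, `s = 1/r`, this is the connection formula for the series of `b` at `u`, with
parameters `-s, x-s+1; x+1`: the solution at infinity of exponent `-s` has the series of `b` at `-u
- r`, and the other has that of `c` at `u`. Reflection turns the Gamma factors into sines. -/
theorem bFun_connection (hr : 0 < r.re) (hr1 : ∀ k : ℤ, k * r ≠ 1) (h : Generic r u)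
    {θ : ℝ} (hθ : θ ∈ Set.Icc 0 (2 * Real.pi)) :
    sin (Real.pi * (u + 1) / r) * bFun r (exp (I * θ))⁻¹ (-u - r) =
      sin (Real.pi * u / r) * exp (-(I * (1 / r) * (θ - Real.pi))) * bFun r (exp (I * θ)) u +
      sin (Real.pi / r) * exp (-(I * (u / r) * (θ - Real.pi))) * cFun r (exp (I * θ))⁻¹ u := by
  have hr0 := ne_zero_of_re_pos hr
  have hs : ∀ k : ℤ, 1 / r ≠ k := fun k e => hr1 k (by rw [← e]; field_simp)
  have hx := fun k : ℤ => (h.ne_int hr0 k).1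
  have hxs : ∀ k : ℤ, u / r + 1 / r ≠ k := fun k => by
    rw [← add_div]; exact (h.ne_int hr0 k).2.1
  have hxs' : ∀ k : ℤ, u / r - 1 / r ≠ k := fun k => by
    rw [← sub_div]; exact (h.ne_int hr0 k).2.2
  have hspos := re_one_div_pos hr
  rw [show (Real.pi : ℂ) * (u + 1) / r = Real.pi * (u / r + 1 / r) by ring,
    show (Real.pi : ℂ) * u / r = Real.pi * (u / r) by ring,
    show (Real.pi : ℂ) / r = Real.pi * (1 / r) by ring]
  simp only [bFun, cFun]
  rw [show (-u - r - 1) / r + 1 = -(u / r + 1 / r) by field_simp; ring,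
    show (-u - r) / r + 1 = -(u / r) by field_simp; ring,
    show (u - 1) / r + 1 = u / r - 1 / r + 1 by ring,
    show -1 / r = -(1 / r) by ring, div_eq_mul_one_div (exp (I * θ))⁻¹ r,
    ordinaryHypergeometric_comm (-(1 / r) + 1)]
  simp only [ordinaryHypergeometric_circle, ordinaryHypergeometric_circle_inv]
  generalize u / r = x at *
  generalize 1 / r = s at *
  have key := hypergeometric_connection (a := -s) (b := x - s + 1) (c := x + 1) (θ := θ)
    (by rw [show x + 1 - -s - (x - s + 1) = s + s by ring, add_re]; linarith)
    (fun k e => hs (-k) (by push_cast; rw [← e]; ring))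
    (fun k e => hxs' (k - 1) (by push_cast; rw [← e]; ring))
    (fun k e => hx (k - 1) (by push_cast; rw [← e]; ring))
    (fun k e => hx (k - 1) (by push_cast; rw [← e]; ring))
    (fun k e => hxs (k - 1) (by push_cast; rw [← e]; ring))
    (fun k e => hs k (by rw [← e]; ring)) hθ
  have hb := Gamma_reflect (x := x - s + 1) fun k e =>
    hxs' (k - 1) (by push_cast; rw [← e]; ring)
  have hp := Gamma_reflect (x := x + s + 1) fun k e =>
    hxs (k - 1) (by push_cast; rw [← e]; ring)
  rw [show x - s + 1 - -s = x + 1 by ring, show x + 1 - -s = x + s + 1 by ring,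
    show x + 1 - (x - s + 1) = s by ring, show -s - (x - s + 1) + 1 = -x by ring,
    show -s - (x + 1) + 1 = -(x + s) by ring, show 1 - -s = s + 1 by ring,
    show x - s + 1 - (x + 1) + 1 = -s + 1 by ring,
    show x + 1 + 1 = x + 2 by ring,
    show (1 : ℂ) - (x - s + 1) = s - x by ring] at key
  rw [show (1 : ℂ) - (x - s + 1) = s - x by ring] at hb
  rw [show (1 : ℂ) - (x + s + 1) = -(x + s) by ring] at hp
  have sin1 : sin (Real.pi * (x + 1)) = -sin (Real.pi * x) := by
    rw [mul_add, mul_one, Complex.sin_add_pi]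
  have sin2 : sin (Real.pi * (x + s + 1)) = -sin (Real.pi * (x + s)) := by
    rw [mul_add, mul_one, Complex.sin_add_pi]
  have sin3 : sin (Real.pi * -s) = -sin (Real.pi * s) := by rw [mul_neg, Complex.sin_neg]
  have hz := exp_ne_zero (I * θ)
  have hE := exp_ne_zero (-(I * s * (θ - Real.pi)))
  have ex1 : exp (-(I * -s * (θ - Real.pi))) = (exp (-(I * s * (θ - Real.pi))))⁻¹ := by
    rw [← exp_neg]; congr 1; ring
  have ex2 : exp (-(I * (x - s + 1) * (θ - Real.pi))) =
      exp (-(I * x * (θ - Real.pi))) * (exp (-(I * s * (θ - Real.pi))))⁻¹ *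
        (-exp (I * θ))⁻¹ := by
    rw [← exp_I_mul_sub_pi, ← exp_neg, ← exp_neg, ← exp_add, ← exp_add]; congr 1; ring
  have s0 : s ≠ 0 := fun e => hs 0 (by simpa using e)
  have gs : Gamma s ≠ 0 := Gamma_ne_zero_of_re_pos hspos
  have gP : Gamma (x + s + 1) ≠ 0 := Gamma_ne_zero_of_add (add_natCast_ne_zero_of_ne_int
    fun k e => hxs (k - 1) (by push_cast; rw [← e]; ring))
  rw [ex1, ex2, sin1, sin3, Gamma_add_one _ s0] at key
  rw [sin2] at hp
  apply mul_left_cancel₀ (mul_ne_zero gP gs)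
  generalize exp (-(I * s * (θ - Real.pi))) = E at *
  generalize exp (-(I * x * (θ - Real.pi))) = X at *
  generalize exp (I * θ) = z at *
  generalize circleSum _ θ = F0 at *
  generalize circleSum _ (-θ) = F1 at *
  generalize circleSum _ (-θ) = F2 at *
  simp only [div_eq_mul_inv, inv_neg] at *
  have hEE := mul_inv_cancel₀ hE
  linear_combination (E * Gamma (x - s + 1)) * key +
    (E * E⁻¹ * Gamma s * (Gamma (-x))⁻¹ * F1) * hb - (F1 * Gamma s * (Gamma (-x))⁻¹) * hp +
    (Real.pi * Gamma s * (Gamma (-x))⁻¹ * F1 - Gamma (x + s + 1) * Gamma s * Gamma (x - s + 1) *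
      sin (Real.pi * s) * s * (Gamma (x + 2))⁻¹ * X * z⁻¹ * F2) * hEE

/-- The same argument with parameters `1-s, x-s+1; x+2`; now `c` at `-u - r` and `b` at `u` appear
at infinity. -/
theorem cFun_connection (hr : 0 < r.re) (hr1 : ∀ k : ℤ, k * r ≠ 1) (h : Generic r u)
    {θ : ℝ} (hθ : θ ∈ Set.Icc 0 (2 * Real.pi)) :
    sin (Real.pi * (u + 1) / r) * (exp (I * θ) * cFun r (exp (I * θ))⁻¹ (-u - r)) =
      sin (Real.pi * u / r) * exp (-(I * (1 / r) * (θ - Real.pi))) * cFun r (exp (I * θ)) u +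
      sin (Real.pi / r) * exp (-(I * (u / r) * (θ - Real.pi))) * bFun r (exp (I * θ))⁻¹ u := by
  have hr0 := ne_zero_of_re_pos hr
  have hs : ∀ k : ℤ, 1 / r ≠ k := fun k e => hr1 k (by rw [← e]; field_simp)
  have hx := fun k : ℤ => (h.ne_int hr0 k).1
  have hxs : ∀ k : ℤ, u / r + 1 / r ≠ k := fun k => by
    rw [← add_div]; exact (h.ne_int hr0 k).2.1
  have hxs' : ∀ k : ℤ, u / r - 1 / r ≠ k := fun k => by
    rw [← sub_div]; exact (h.ne_int hr0 k).2.2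
  have hspos := re_one_div_pos hr
  rw [show (Real.pi : ℂ) * (u + 1) / r = Real.pi * (u / r + 1 / r) by ring,
    show (Real.pi : ℂ) * u / r = Real.pi * (u / r) by ring,
    show (Real.pi : ℂ) / r = Real.pi * (1 / r) by ring]
  simp only [bFun, cFun]
  rw [show (-u - r - 1) / r + 1 = -(u / r + 1 / r) by field_simp; ring,
    show (-u - r) / r + 2 = 1 - u / r by field_simp; ring,
    show (u - 1) / r + 1 = u / r - 1 / r + 1 by ring,
    show -1 / r = -(1 / r) by ring, div_eq_mul_one_div (exp (I * θ))⁻¹ r,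
    div_eq_mul_one_div (exp (I * θ)) r, ordinaryHypergeometric_comm (-(1 / r)),
    show -(1 / r) + 1 = 1 - 1 / r by ring]
  simp only [ordinaryHypergeometric_circle, ordinaryHypergeometric_circle_inv]
  generalize u / r = x at *
  generalize 1 / r = s at *
  have key := hypergeometric_connection (a := 1 - s) (b := x - s + 1) (c := x + 2) (θ := θ)
    (by rw [show x + 2 - (1 - s) - (x - s + 1) = s + s by ring, add_re]; linarith)
    (fun k e => hs (1 - k) (by push_cast; rw [← e]; ring))
    (fun k e => hxs' (k - 1) (by push_cast; rw [← e]; ring))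
    (fun k e => hx (k - 2) (by push_cast; rw [← e]; ring))
    (fun k e => hx k (by rw [← e]; ring))
    (fun k e => hxs (k - 1) (by push_cast; rw [← e]; ring))
    (fun k e => hs (k - 1) (by push_cast; rw [← e]; ring)) hθ
  have hb := Gamma_reflect (x := x - s + 1) fun k e =>
    hxs' (k - 1) (by push_cast; rw [← e]; ring)
  have hp := Gamma_reflect (x := x + s + 1) fun k e =>
    hxs (k - 1) (by push_cast; rw [← e]; ring)
  rw [show x - s + 1 - (1 - s) = x by ring, show x + 2 - (1 - s) = x + s + 1 by ring,
    show x + 2 - (x - s + 1) = s + 1 by ring, show 1 - s - (x - s + 1) + 1 = 1 - x by ring,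
    show 1 - s - (x + 2) + 1 = -(x + s) by ring, show 1 - (1 - s) = s by ring,
    show x - s + 1 - (x + 2) + 1 = -s by ring,
    show (1 : ℂ) - (x - s + 1) = s - x by ring] at key
  rw [show (1 : ℂ) - (x - s + 1) = s - x by ring] at hb
  rw [show (1 : ℂ) - (x + s + 1) = -(x + s) by ring] at hp
  have sin2 : sin (Real.pi * (x + s + 1)) = -sin (Real.pi * (x + s)) := by
    rw [mul_add, mul_one, Complex.sin_add_pi]
  have sin3 : sin (Real.pi * (1 - s)) = sin (Real.pi * s) := by
    rw [mul_sub, mul_one, Complex.sin_pi_sub]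
  have hz := exp_ne_zero (I * θ)
  have hE := exp_ne_zero (-(I * s * (θ - Real.pi)))
  have ex1 : exp (-(I * (1 - s) * (θ - Real.pi))) = (exp (-(I * s * (θ - Real.pi))))⁻¹ *
        (-exp (I * θ))⁻¹ := by
    rw [← exp_I_mul_sub_pi, ← exp_neg, ← exp_neg, ← exp_add]; congr 1; ring
  have ex2 : exp (-(I * (x - s + 1) * (θ - Real.pi))) =
      exp (-(I * x * (θ - Real.pi))) * (exp (-(I * s * (θ - Real.pi))))⁻¹ *
        (-exp (I * θ))⁻¹ := by
    rw [← exp_I_mul_sub_pi, ← exp_neg, ← exp_neg, ← exp_add, ← exp_add]; congr 1; ring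
  have s0 : s ≠ 0 := fun e => hs 0 (by simpa using e)
  have gs : Gamma s ≠ 0 := Gamma_ne_zero_of_re_pos hspos
  have gP : Gamma (x + s + 1) ≠ 0 := Gamma_ne_zero_of_add (add_natCast_ne_zero_of_ne_int
    fun k e => hxs (k - 1) (by push_cast; rw [← e]; ring))
  rw [ex1, ex2, sin3, Gamma_add_one _ s0] at key
  rw [sin2] at hp
  apply mul_left_cancel₀ (mul_ne_zero gP gs)
  generalize exp (-(I * s * (θ - Real.pi))) = E at *
  generalize exp (-(I * x * (θ - Real.pi))) = X at *
  generalize exp (I * θ) = z at *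
  generalize circleSum _ θ = F0 at *
  generalize circleSum _ (-θ) = F1 at *
  generalize circleSum _ (-θ) = F2 at *
  simp only [div_eq_mul_inv, inv_neg] at *
  have hEE := mul_inv_cancel₀ hE
  have hzz := mul_inv_cancel₀ hz
  set T1 := F1 * s * Gamma s * (Gamma (1 - x))⁻¹
  set T2 := Gamma (x + s + 1) * Gamma s * Gamma (x - s + 1) *
      sin (Real.pi * s) * (Gamma (x + 1))⁻¹ * X * F2
  linear_combination (z * E * Gamma (x - s + 1)) * key -
    (z * z⁻¹ * E * E⁻¹ * T1) * hb + (z * z⁻¹ * T1) * hp +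
    (z * z⁻¹ * (T2 - Real.pi * T1)) * hEE + T2 * hzz

end

end

end DeformedYangian

namespace DeformedYangian

noncomputable section

open Complex

/-! ### Finite Fourier sums of cotangents -/

lemma omega_isPrimitiveRoot (N : ℕ) (hN : N ≠ 0) : IsPrimitiveRoot (omega N) N :=
  Complex.isPrimitiveRoot_exp N hN

lemma omega_pow_self (N : ℕ) (hN : N ≠ 0) : omega N ^ N = 1 := (omega_isPrimitiveRoot N hN).1

lemma omega_ne_zero (N : ℕ) : omega N ≠ 0 := exp_ne_zero _

lemma sum_omega_pow (N : ℕ) (hN : N ≠ 0) (k : ℕ) :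
    ∑ m : Fin N, omega N ^ (k * m.val) = if N ∣ k then (N : ℂ) else 0 := by
  rw [Fin.sum_univ_eq_sum_range (fun m => omega N ^ (k * m)) N]
  simp only [pow_mul]
  split_ifs with h
  · rw [(omega_isPrimitiveRoot N hN).pow_eq_one_iff_dvd k |>.mpr h]; simp
  · have h1 : omega N ^ k ≠ 1 := fun e =>
      h ((omega_isPrimitiveRoot N hN).pow_eq_one_iff_dvd k |>.mp e)
    rw [geom_sum_eq h1, ← pow_mul, mul_comm, pow_mul, omega_pow_self N hN]
    simp

/-- With `q = e^{2iw}`, one has `cot w = -i (2/(1-q) - 1)` and `1/(1-q) = ∑_{j<N} q^j / (1 - q^N)`.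
In this form a shift of `w` by `πm/N` only multiplies `q^j` by `ω^{jm}`, since `q^N` is unchanged.
-/
lemma cot_eq_geom_sum (N : ℕ) {w : ℂ} (hw : sin (N * w) ≠ 0) :
    cot w = -I * (2 / (1 - exp (2 * I * w) ^ N) *
      ∑ j ∈ Finset.range N, exp (2 * I * w) ^ j - 1) ∧ exp (2 * I * w) ^ N ≠ 1 := by
  have hN : exp (2 * I * w) ^ N ≠ 1 := by
    rw [← exp_nat_mul]
    intro e
    obtain ⟨k, hk⟩ := exp_eq_one_iff.mp e
    refine hw (Complex.sin_eq_zero_iff.mpr ⟨k, ?_⟩)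
    have h2I : (2 * I : ℂ) ≠ 0 := by simp
    apply mul_left_cancel₀ h2I
    linear_combination hk
  have h1 : exp (2 * I * w) ≠ 1 := fun e => hN (by rw [e, one_pow])
  refine ⟨?_, hN⟩
  rw [geom_sum_eq h1]
  have hd1 : 1 - exp (2 * I * w) ^ N ≠ 0 := sub_ne_zero.mpr (Ne.symm hN)
  have hd2 : exp (2 * I * w) - 1 ≠ 0 := sub_ne_zero.mpr h1
  have hd3 : exp (2 * I * w) ^ N - 1 ≠ 0 := sub_ne_zero.mpr hN
  have hd4 : 1 - exp (2 * I * w) ≠ 0 := sub_ne_zero.mpr (Ne.symm h1)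
  rw [Complex.cot_eq_exp_ratio]
  rw [show 2 / (1 - exp (2 * I * w) ^ N) * ((exp (2 * I * w) ^ N - 1) / (exp (2 * I * w) - 1)) =
    -(2 / (exp (2 * I * w) - 1)) by field_simp; ring]
  field_simp
  ring_nf
  simp only [I_sq]
  ring

/-- `∑_m ω^{km} cot(w + π m / N)`. -/
def cotSum (N : ℕ) (w : ℂ) (k : Fin N) : ℂ :=
  ∑ m : Fin N, omega N ^ (k.val * m.val) * cot (w + Real.pi * m.val / N)

lemma exp_shift (N : ℕ) (w : ℂ) (m : ℕ) :
    exp (2 * I * (w + Real.pi * m / N)) = exp (2 * I * w) * omega N ^ m := by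
  rw [omega, ← exp_nat_mul, ← exp_add]; congr 1; ring

lemma sin_shift_ne_zero (N : ℕ) (hN : N ≠ 0) {w : ℂ} (hw : sin (N * w) ≠ 0) (m : ℕ) :
    sin (N * (w + Real.pi * m / N)) ≠ 0 := by
  have hN' : (N : ℂ) ≠ 0 := Nat.cast_ne_zero.mpr hN
  rw [show (N : ℂ) * (w + Real.pi * m / N) = N * w + m * Real.pi by field_simp]
  intro e
  obtain ⟨k, hk⟩ := Complex.sin_eq_zero_iff.mp e
  exact hw (Complex.sin_eq_zero_iff.mpr ⟨k - m, by push_cast; linear_combination hk⟩)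

/-- Orthogonality of characters leaves the single `j < N` with `N ∣ k + j`: it is `j = 0` if `k = 0`
and `j = N - k` otherwise. The last term, from the `-1`, survives only for `k = 0`, which is why a
cotangent appears there and a pure exponential elsewhere. -/
lemma cotSum_eq (N : ℕ) (hN : N ≠ 0) {w : ℂ} (hw : sin (N * w) ≠ 0) (k : Fin N) :
    cotSum N w k = -I * (2 / (1 - exp (2 * I * w) ^ N) *
      (∑ j ∈ Finset.range N, exp (2 * I * w) ^ j * (if N ∣ k.val + j then (N : ℂ) else 0)) -
        if N ∣ k.val then (N : ℂ) else 0) := by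
  have hterm : ∀ m : Fin N, omega N ^ (k.val * m.val) * cot (w + Real.pi * m.val / N) =
      -I * (2 / (1 - exp (2 * I * w) ^ N) *
        (∑ j ∈ Finset.range N, exp (2 * I * w) ^ j * omega N ^ ((k.val + j) * m.val)) -
        omega N ^ (k.val * m.val)) := by
    intro m
    rw [(cot_eq_geom_sum N (sin_shift_ne_zero N hN hw m.val)).1]
    have e : (exp (2 * I * w) * omega N ^ m.val) ^ N = exp (2 * I * w) ^ N := by
      rw [mul_pow, ← pow_mul, mul_comm m.val N, pow_mul (omega N) N, omega_pow_self N hN, one_pow,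
        mul_one]
    rw [exp_shift, e, mul_left_comm, mul_sub, mul_one, mul_left_comm, Finset.mul_sum]
    congr 3
    refine Finset.sum_congr rfl fun j _ => ?_
    rw [add_mul, pow_add, mul_pow, ← pow_mul, mul_comm m.val j]; ring
  rw [cotSum, Finset.sum_congr rfl fun m _ => hterm m, ← Finset.mul_sum, Finset.sum_sub_distrib,
    ← Finset.mul_sum, Finset.sum_comm, sum_omega_pow N hN]
  simp only [← Finset.mul_sum, sum_omega_pow N hN]

lemma cotSum_of_val_eq_zero (N : ℕ) (hN : N ≠ 0) {w : ℂ} (hw : sin (N * w) ≠ 0) {k : Fin N}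
    (hk : k.val = 0) : cotSum N w k = N * cot (N * w) := by
  rw [cotSum_eq N hN hw, hk, Finset.sum_eq_single_of_mem 0 (by simp; omega)]
  · have h := (cot_eq_geom_sum 1 (w := N * w) (by simpa using hw)).1
    rw [show 2 * I * (N * w) = N * (2 * I * w) by ring, exp_nat_mul] at h
    rw [h]
    simp
    ring
  · intro j hj hj0
    rw [if_neg, mul_zero]
    intro hd
    rw [zero_add] at hd
    exact absurd (Nat.le_of_dvd (by omega) hd) (by simpa using hj)

lemma cotSum_of_val_ne_zero (N : ℕ) (hN : N ≠ 0) {w : ℂ} (hw : sin (N * w) ≠ 0) {k : Fin N}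
    (hk : k.val ≠ 0) :
    cotSum N w k = N * (exp (I * (N * w)) / sin (N * w)) * exp (-(2 * I * w * k.val)) := by
  have hkN := k.isLt
  have hnd : ¬ N ∣ k.val := fun hd => absurd (Nat.le_of_dvd (by omega) hd) (by omega)
  rw [cotSum_eq N hN hw, Finset.sum_eq_single_of_mem (N - k.val) (by simp; omega), if_neg hnd,
    if_pos (by rw [Nat.add_sub_cancel' hkN.le]), sub_zero]
  · have e1 : exp (2 * I * w) ^ (N - k.val) =
        exp (I * (N * w)) * exp (I * (N * w)) * exp (-(2 * I * w * k.val)) := by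
      rw [← exp_nat_mul, ← exp_add, ← exp_add, Nat.cast_sub hkN.le]; congr 1; ring
    have e2 : exp (2 * I * w) ^ N = exp (I * (N * w)) * exp (I * (N * w)) := by
      rw [← exp_nat_mul, ← exp_add]; congr 1; ring
    have e3 : sin (N * w) * (2 * I) * exp (I * (N * w)) =
        exp (I * (N * w)) * exp (I * (N * w)) - 1 := by
      have := exp_sub_exp_neg (N * w)
      have e4 : exp (-(I * (N * w))) * exp (I * (N * w)) = 1 := by rw [← exp_add]; simp
      linear_combination (-exp (I * (N * w))) * this - e4
    have hA := exp_ne_zero (I * (N * w))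
    rw [e1, e2, show 1 - exp (I * (N * w)) * exp (I * (N * w)) =
      -(sin (N * w) * (2 * I) * exp (I * (N * w))) by rw [e3]; ring]
    generalize exp (I * (N * w)) = A at *
    generalize exp (-(2 * I * w * k.val)) = B at *
    generalize sin (N * w) = S at *
    field_simp
  · intro j hj hj0
    rw [if_neg, mul_zero]
    intro hd
    have hjN : j < N := by simpa using hj
    have hkj : k.val + j = N := by
      obtain ⟨q, hq⟩ := hd
      have : q = 1 := by
        rcases q with _ | _ | q
        · omega
        · rfl
        · exfalso
          have : N * (q + 1 + 1) = N * q + 2 * N := by ring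
          have h0 : 0 ≤ N * q := Nat.zero_le _
          omega
      rw [hq, this, mul_one]
    omega

/-! ### The gauge transformation of `S̄` -/

/-- The additive character `ω^{ij}`. -/
def chi {N : ℕ} (i j : Fin N) : ℂ := omega N ^ (i.val * j.val)

lemma omega_pow_mod (N : ℕ) (hN : N ≠ 0) (k : ℕ) : omega N ^ (k % N) = omega N ^ k := by
  conv_rhs => rw [← Nat.mod_add_div k N, pow_add, pow_mul, omega_pow_self N hN, one_pow, mul_one]

section

variable {N : ℕ}

lemma chi_comm (i j : Fin N) : chi i j = chi j i := by rw [chi, chi, mul_comm]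

lemma chi_ne_zero (i j : Fin N) : chi i j ≠ 0 := pow_ne_zero _ (omega_ne_zero N)

lemma gaugeV_eq (i j : Fin N) :
    gaugeV N i j = ((Real.sqrt N : ℝ) : ℂ)⁻¹ * omega N ^ i.val * chi i j := by
  rw [gaugeV, chi, mul_assoc, ← pow_add]
  congr 2
  ring

lemma sqrt_inv_mul_self : ((Real.sqrt N : ℝ) : ℂ)⁻¹ * ((Real.sqrt N : ℝ) : ℂ)⁻¹ = (N : ℂ)⁻¹ := by
  rw [← mul_inv, ← ofReal_mul, Real.mul_self_sqrt (Nat.cast_nonneg N), ofReal_natCast]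

variable [NeZero N]

lemma chi_add (i j k : Fin N) : chi i (j + k) = chi i j * chi i k := by
  have hN := NeZero.ne N
  rw [chi, chi, chi, Fin.val_add, mul_comm i.val ((j.val + k.val) % N), pow_mul,
    omega_pow_mod N hN, ← pow_mul, ← pow_add]
  congr 1
  ring

lemma chi_sub (i j k : Fin N) : chi i (j - k) = chi i j / chi i k := by
  rw [eq_div_iff (chi_ne_zero i k), ← chi_add, sub_add_cancel]

lemma sum_chi (k : Fin N) : ∑ m, chi k m = if k = 0 then (N : ℂ) else 0 := by
  have h := sum_omega_pow N (NeZero.ne N) k.val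
  rw [show (∑ m, chi k m) = ∑ m : Fin N, omega N ^ (k.val * m.val) from rfl, h]
  have : N ∣ k.val ↔ k = 0 := by
    rw [Fin.ext_iff, Fin.val_zero]
    exact ⟨fun hd => Nat.eq_zero_of_dvd_of_lt hd k.isLt, fun e => by simp [e]⟩
  simp only [this]

/-- Up to the row factors `ω^i`, which come from the labels starting at `1`, `V` is the Fourier
matrix of `ℤ/N`; its inverse is built from the inverse characters. -/
theorem isUnit_det_gaugeV : IsUnit (gaugeV N).det := by
  have hN : (N : ℂ) ≠ 0 := Nat.cast_ne_zero.mpr (NeZero.ne N)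
  refine Matrix.isUnit_det_of_right_inverse
    (B := Matrix.of fun j k : Fin N =>
      ((Real.sqrt N : ℝ) : ℂ)⁻¹ * (omega N ^ k.val)⁻¹ * (chi k j)⁻¹) ?_
  ext i k
  simp only [Matrix.mul_apply, Matrix.of_apply]
  have e : ∀ j, gaugeV N i j * (((Real.sqrt N : ℝ) : ℂ)⁻¹ * (omega N ^ k.val)⁻¹ * (chi k j)⁻¹) =
      (N : ℂ)⁻¹ * (omega N ^ i.val * (omega N ^ k.val)⁻¹) * chi (i - k) j := by
    intro j
    rw [gaugeV_eq, ← sqrt_inv_mul_self, chi_comm (i - k), chi_sub, chi_comm j i, chi_comm j k]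
    ring
  rw [Finset.sum_congr rfl fun j _ => e j, ← Finset.mul_sum, sum_chi, Matrix.one_apply]
  by_cases h : i = k
  · subst h
    have := pow_ne_zero i.val (omega_ne_zero N)
    simp
    field_simp
  · simp [h, sub_eq_zero]

/-- Periodicity of `cot` allows a difference of labels to be reduced modulo `N`, so that sums over
`Fin N` can be reindexed by group translations. -/
lemma cot_add_pi_mul_sub (w : ℂ) (p q : Fin N) :
    cot (w + Real.pi * ((p.val : ℂ) - q.val) / N) =
      cot (w + Real.pi * ((p - q : Fin N).val) / N) := by
  have hN : (N : ℂ) ≠ 0 := Nat.cast_ne_zero.mpr (NeZero.ne N)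
  have hcot : ∀ x : ℂ, cot (x + Real.pi) = cot x := fun x => by
    rw [Complex.cot_eq_cos_div_sin, Complex.cot_eq_cos_div_sin, Complex.cos_add_pi,
      Complex.sin_add_pi, neg_div_neg_eq]
  by_cases h : q ≤ p
  · rw [Fin.sub_val_of_le h, Nat.cast_sub h]
  · have h2 : ((p - q : Fin N).val : ℂ) = p.val - q.val + N := by
      have h1 : (p - q : Fin N).val + q.val = p.val + N := by
        rw [Fin.coe_sub_iff_lt.mpr (not_le.mp h)]
        have := q.isLt
        omega
      have : ((p - q : Fin N).val : ℂ) + q.val = p.val + N := by exact_mod_cast h1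
      linear_combination this
    rw [h2, ← hcot]
    congr 1
    field_simp
    ring

end

end

end DeformedYangian

namespace DeformedYangian

noncomputable section

open Complex

/-! ### Matrices supported on the identity and the flip -/

/-- The matrix with entries `γ a` at `(aa, aa)` and, for `a ≠ b`, `α a b` at `(ab, ab)` and
`β a b` at `(ab, ba)`. -/
def exchangeMatrix {N : ℕ} (γ : Fin N → ℂ) (α β : Fin N → Fin N → ℂ) :
    Matrix (Fin N × Fin N) (Fin N × Fin N) ℂ :=
  fun i j =>
    if i.1 = i.2 then (if j = i then γ i.1 else 0)
    else if j = i then α i.1 i.2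
    else if j = i.swap then β i.1 i.2
    else 0

section

variable {N : ℕ}

lemma swap_ne_self {i : Fin N × Fin N} (h : i.1 ≠ i.2) : i.swap ≠ i := fun e =>
  h (congrArg Prod.fst e).symm

lemma exchangeMatrix_mul_apply (γ : Fin N → ℂ) (α β : Fin N → Fin N → ℂ)
    (M : Matrix (Fin N × Fin N) (Fin N × Fin N) ℂ) (i k : Fin N × Fin N) :
    (exchangeMatrix γ α β * M) i k = if i.1 = i.2 then γ i.1 * M i k
      else α i.1 i.2 * M i k + β i.1 i.2 * M i.swap k := by
  rw [Matrix.mul_apply]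
  split_ifs with h
  · rw [Finset.sum_eq_single_of_mem i (Finset.mem_univ _) fun j _ hj => by
      simp [exchangeMatrix, h, hj]]
    simp [exchangeMatrix, h]
  · have hs := swap_ne_self h
    rw [Finset.sum_eq_add_of_mem i i.swap (Finset.mem_univ _) (Finset.mem_univ _) hs.symm
      fun j _ hj => by simp [exchangeMatrix, h, hj.1, hj.2]]
    simp [exchangeMatrix, h, hs]

/-- These matrices are closed under multiplication, block by block on `{ab, ba}`; every later matrix
identity is checked through this. -/
lemma exchangeMatrix_mul (γ γ' : Fin N → ℂ) (α β α' β' : Fin N → Fin N → ℂ) :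
    exchangeMatrix γ α β * exchangeMatrix γ' α' β' =
      exchangeMatrix (fun a => γ a * γ' a) (fun a b => α a b * α' a b + β a b * β' b a)
        (fun a b => α a b * β' a b + β a b * α' b a) := by
  ext i k
  rw [exchangeMatrix_mul_apply]
  by_cases h : i.1 = i.2
  · simp only [exchangeMatrix, h, if_true, mul_ite, mul_zero]
  · have hs := swap_ne_self h
    have h' : ¬ i.2 = i.1 := fun e => h e.symm
    simp only [exchangeMatrix, h, if_false, Prod.fst_swap, Prod.snd_swap, h', Prod.swap_swap]
    by_cases h1 : k = i
    · subst h1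
      simp [hs.symm]
    · by_cases h2 : k = i.swap
      · subst h2
        simp [hs]
      · simp [h1, h2]

lemma exchangeMatrix_congr {γ γ' : Fin N → ℂ} {α β α' β' : Fin N → Fin N → ℂ}
    (hγ : ∀ a, γ a = γ' a) (hα : ∀ a b, a ≠ b → α a b = α' a b)
    (hβ : ∀ a b, a ≠ b → β a b = β' a b) : exchangeMatrix γ α β = exchangeMatrix γ' α' β' := by
  ext i k
  by_cases h : i.1 = i.2
  · simp [exchangeMatrix, h, hγ]
  · simp [exchangeMatrix, h, hα _ _ h, hβ _ _ h]

lemma smul_exchangeMatrix (x : ℂ) (γ : Fin N → ℂ) (α β : Fin N → Fin N → ℂ) :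
    x • exchangeMatrix γ α β =
      exchangeMatrix (fun a => x * γ a) (fun a b => x * α a b) (fun a b => x * β a b) := by
  ext i k
  simp only [Matrix.smul_apply, exchangeMatrix, smul_eq_mul, mul_ite, mul_zero]

lemma exchangeMatrix_one :
    exchangeMatrix (fun _ : Fin N => 1) (fun _ _ => 1) (fun _ _ => 0) = 1 := by
  ext i k
  simp [exchangeMatrix, Matrix.one_apply, eq_comm]

lemma flip21_exchangeMatrix (γ : Fin N → ℂ) (α β : Fin N → Fin N → ℂ) :
    flip21 (exchangeMatrix γ α β) =
      exchangeMatrix γ (fun a b => α b a) (fun a b => β b a) := by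
  ext i k
  simp only [flip21, Matrix.submatrix_apply, exchangeMatrix, Prod.fst_swap, Prod.snd_swap,
    Prod.swap_swap, Prod.swap_inj]
  by_cases h : i.1 = i.2
  · simp [h]
  · have h' : ¬ i.2 = i.1 := fun e => h e.symm
    have e : (k.swap = i) ↔ (k = i.swap) := by
      rw [← Prod.swap_inj, Prod.swap_swap]
    simp only [h, h', if_false, e]

lemma twistF_eq (r u : ℂ) : twistF N r u = exchangeMatrix (fun _ => 1)
    (fun a b => bFun r (omegaDiff N a b) u) (fun a b => cFun r (omegaDiff N a b) u) := rfl

lemma yangR_eq (u : ℂ) : yangR N u = exchangeMatrix (fun _ => 1)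
    (fun _ _ => u / (u + 1)) (fun _ _ => 1 / (u + 1)) := rfl

lemma phiOne_eq : phiOne N = exchangeMatrix (fun a => omega N ^ (-((a.val : ℤ) + 1)))
    (fun a _ => omega N ^ (-((a.val : ℤ) + 1))) (fun _ _ => 0) := by
  ext i k
  rw [phiOne, Matrix.kroneckerMap_apply, Matrix.diagonal_apply, Matrix.one_apply]
  by_cases h : k = i
  · subst h; simp [exchangeMatrix]
  · have : ¬ (i.1 = k.1 ∧ i.2 = k.2) := fun e => h (Prod.ext e.1.symm e.2.symm)
    by_cases h1 : i.1 = k.1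
    · have h2 : ¬ i.2 = k.2 := fun e => this ⟨h1, e⟩
      simp [exchangeMatrix, h, h2]
    · simp [exchangeMatrix, h, h1]

lemma phiOne_inv : (phiOne N)⁻¹ = exchangeMatrix (fun a => omega N ^ ((a.val : ℤ) + 1))
    (fun a _ => omega N ^ ((a.val : ℤ) + 1)) (fun _ _ => 0) := by
  refine Matrix.inv_eq_right_inv ?_
  rw [phiOne_eq, exchangeMatrix_mul, ← exchangeMatrix_one]
  refine exchangeMatrix_congr (fun a => ?_) (fun a b _ => ?_) (fun a b _ => by simp)
  · rw [← zpow_add₀ (omega_ne_zero N), neg_add_cancel, zpow_zero]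
  · rw [← zpow_add₀ (omega_ne_zero N), neg_add_cancel, zpow_zero]; simp

/-! ### The entries of `S` -/

lemma cotSum_eq_sum_chi (w : ℂ) (k : Fin N) :
    cotSum N w k = ∑ m : Fin N, chi k m * cot (w + Real.pi * m.val / N) := rfl

variable [NeZero N]

/-- The addition formula for `sin (x + y) / (sin x sin y)`: the arguments of the two denominators
sum to that of the numerator because `(b - c) + (c - a) = b - a`. -/
lemma Sbar_apply {r u : ℂ} (hr0 : r ≠ 0) (hs : ∀ k : ℤ, 1 / r ≠ k) (hx : ∀ k : ℤ, u / r ≠ k)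
    (p q c d : Fin N) :
    Sbar N r u (p, q) (c, d) = if p + q = c + d then
      cot (Real.pi * u / (N * r) + Real.pi * (q - c : Fin N).val / N) +
        cot (Real.pi / (N * r) + Real.pi * (c - p : Fin N).val / N) else 0 := by
  have hN : (N : ℂ) ≠ 0 := Nat.cast_ne_zero.mpr (NeZero.ne N)
  rw [Sbar]
  dsimp only
  refine if_congr Iff.rfl ?_ rfl
  rw [← cot_add_pi_mul_sub, ← cot_add_pi_mul_sub, Complex.cot_eq_cos_div_sin,
    Complex.cot_eq_cos_div_sin]
  set x := Real.pi * u / (N * r) + Real.pi * ((q.val : ℂ) - c.val) / N with hxdef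
  set y := Real.pi / (N * r) + Real.pi * ((c.val : ℂ) - p.val) / N with hydef
  have e1 : Real.pi / (N * r) * (u + 1 + ((q.val : ℂ) - p.val) * r) = x + y := by
    rw [hxdef, hydef]; field_simp; ring
  have e2 : Real.pi / (N * r) * (u + ((q.val : ℂ) - c.val) * r) = x := by
    rw [hxdef]; field_simp
  have e3 : Real.pi / (N * r) * (1 - ((p.val : ℂ) - c.val) * r) = y := by
    rw [hydef]; field_simp; ring
  have hpi : (Real.pi : ℂ) ≠ 0 := ofReal_ne_zero.mpr Real.pi_ne_zero
  have n1 : sin x ≠ 0 := fun e => by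
    obtain ⟨k, hk⟩ := Complex.sin_eq_zero_iff.mp e
    apply hx (k * N - q.val + c.val)
    rw [hxdef] at hk
    field_simp at hk
    push_cast
    field_simp
    linear_combination hk
  have n2 : sin y ≠ 0 := fun e => by
    obtain ⟨k, hk⟩ := Complex.sin_eq_zero_iff.mp e
    apply hs (k * N - c.val + p.val)
    rw [hydef] at hk
    field_simp at hk
    push_cast
    field_simp
    linear_combination hk
  rw [e1, e2, e3, Complex.sin_add]
  field_simp
  ring

/-- Proved as an intertwining relation with `V ⊗ V`, so that the inverse of `V` is never computed.
One cotangent depends only on `d - p`, the other only on `c - p`. Summed against the characters, the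
former exchanges `c` and `d` and gives the flip part, the latter keeps them in place and gives the
identity part. -/
theorem Smat_eq {r u : ℂ} (hr0 : r ≠ 0) (hs : ∀ k : ℤ, 1 / r ≠ k) (hx : ∀ k : ℤ, u / r ≠ k) :
    Smat N r u = exchangeMatrix
      (fun _ => cotSum N (Real.pi / (N * r)) 0 + cotSum N (Real.pi * u / (N * r)) 0)
      (fun a b => cotSum N (Real.pi / (N * r)) (b - a))
      (fun a b => cotSum N (Real.pi * u / (N * r)) (b - a)) := by
  set w1 := Real.pi * u / (N * r) with hw1
  set w2 := (Real.pi : ℂ) / (N * r) with hw2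
  have hdet : IsUnit (gaugeV N ⊗ₖ gaugeV N).det := by
    rw [Matrix.det_kronecker]
    exact (isUnit_det_gaugeV.pow _).mul (isUnit_det_gaugeV.pow _)
  rw [Smat, gauge]
  have key : (gaugeV N ⊗ₖ gaugeV N) * Sbar N r u = exchangeMatrix
      (fun _ => cotSum N w2 0 + cotSum N w1 0) (fun a b => cotSum N w2 (b - a))
      (fun a b => cotSum N w1 (b - a)) * (gaugeV N ⊗ₖ gaugeV N) := by
    ext ⟨a, b⟩ ⟨c, d⟩
    set K : ℂ := (N : ℂ)⁻¹ * (omega N ^ a.val * omega N ^ b.val) with hK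
    have hV : ∀ i j k l : Fin N, gaugeV N i j * gaugeV N k l =
        (N : ℂ)⁻¹ * (omega N ^ i.val * omega N ^ k.val) * (chi i j * chi k l) := by
      intro i j k l
      rw [gaugeV_eq, gaugeV_eq, ← sqrt_inv_mul_self]; ring
    have hleft : ((gaugeV N ⊗ₖ gaugeV N) * Sbar N r u) (a, b) (c, d) =
        K * (chi a d * chi b c * cotSum N w1 (b - a) + chi a c * chi b d * cotSum N w2 (b - a)) := by
      rw [Matrix.mul_apply, Fintype.sum_prod_type]
      have hinner : ∀ p : Fin N, ∑ q, (gaugeV N ⊗ₖ gaugeV N) (a, b) (p, q) *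
          Sbar N r u (p, q) (c, d) =
          K * (chi a p * chi b (c + d - p) * cot (w1 + Real.pi * (d - p : Fin N).val / N)) +
          K * (chi a p * chi b (c + d - p) * cot (w2 + Real.pi * (c - p : Fin N).val / N)) := by
        intro p
        -- The support condition modulo `N` forces `q = c + d - p`.
        rw [Finset.sum_eq_single_of_mem (c + d - p) (Finset.mem_univ _)]
        · rw [Sbar_apply hr0 hs hx, if_pos (by abel), Matrix.kroneckerMap_apply, hV,
            show c + d - p - c = d - p by abel]
          ring
        · intro q _ hq
          rw [Sbar_apply hr0 hs hx, if_neg, mul_zero]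
          intro e
          exact hq (by rw [← e]; abel)
      rw [Finset.sum_congr rfl fun p _ => hinner p, Finset.sum_add_distrib, mul_add,
        cotSum_eq_sum_chi, cotSum_eq_sum_chi, Finset.mul_sum, Finset.mul_sum, Finset.mul_sum,
        Finset.mul_sum]
      congr 1
      · rw [← Equiv.sum_comp (Equiv.subLeft d)]
        refine Finset.sum_congr rfl fun m _ => ?_
        simp only [Equiv.subLeft_apply]
        rw [show d - (d - m) = m by abel, show c + d - (d - m) = c + m by abel, chi_add,
          chi_sub, chi_comm (b - a), chi_sub, chi_comm m a, chi_comm m b]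
        ring
      · rw [← Equiv.sum_comp (Equiv.subLeft c)]
        refine Finset.sum_congr rfl fun m _ => ?_
        simp only [Equiv.subLeft_apply]
        rw [show c - (c - m) = m by abel, show c + d - (c - m) = d + m by abel, chi_add,
          chi_sub, chi_comm (b - a), chi_sub, chi_comm m a, chi_comm m b]
        ring
    rw [hleft, exchangeMatrix_mul_apply]
    simp only [Matrix.kroneckerMap_apply, Prod.swap_prod_mk, hV]
    by_cases h : a = b
    · subst h
      simp only [if_true, sub_self]
      ring
    · simp only [h, if_false]
      ring
  rw [key, Matrix.mul_nonsing_inv_cancel_right _ _ hdet]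

end

end

end DeformedYangian

namespace DeformedYangian

noncomputable section

open Complex

/-! ### The twisted `R`-matrix -/

section

variable {N : ℕ}

lemma omegaDiff_inv (a b : Fin N) : (omegaDiff N a b)⁻¹ = omegaDiff N b a := by
  rw [omegaDiff, omegaDiff, ← zpow_neg, neg_sub]

lemma norm_omegaDiff (a b : Fin N) : ‖omegaDiff N a b‖ = 1 := by
  have : ‖omega N‖ = 1 := by
    rw [omega, show 2 * Real.pi * I / (N : ℂ) = ((2 * Real.pi / N : ℝ) : ℂ) * I by
      push_cast; ring]
    exact norm_exp_ofReal_mul_I _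
  rw [omegaDiff, norm_zpow, this, one_zpow]

variable {r u : ℂ}

/-- Conjugation by `φ ⊗ 1` fixes the diagonal entries and multiplies the flip entry at `ab` by
`ω^{a-b}`, which is the `z⁻¹` of `bFun_add` and `cFun_add`. -/
theorem twistF_add (hr : 0 < r.re) (h : Regular r u) :
    twistF N r (u + r) = (phiOne N)⁻¹ * twistF N r u * phiOne N * yangR N (u + r) := by
  have hur : u + r + 1 ≠ 0 := fun e => (h 0).2.2 (by push_cast; linear_combination e)
  rw [phiOne_inv, phiOne_eq, twistF_eq, twistF_eq, yangR_eq, exchangeMatrix_mul,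
    exchangeMatrix_mul, exchangeMatrix_mul]
  have hw := omega_ne_zero N
  have hz : ∀ a : Fin N, omega N ^ ((a.val : ℤ) + 1) * omega N ^ (-((a.val : ℤ) + 1)) = 1 :=
    fun a => by rw [← zpow_add₀ hw, add_neg_cancel, zpow_zero]
  have hd : ∀ a b : Fin N, omega N ^ ((a.val : ℤ) + 1) * omega N ^ (-((b.val : ℤ) + 1)) =
      (omegaDiff N a b)⁻¹ := fun a b => by
    rw [omegaDiff_inv, omegaDiff, ← zpow_add₀ hw]; congr 1; ring
  refine exchangeMatrix_congr (fun a => ?_) (fun a b hab => ?_) (fun a b hab => ?_)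
  · linear_combination -hz a
  · apply mul_left_cancel₀ hur
    rw [bFun_add hr h (norm_omegaDiff a b)]
    field_simp
    linear_combination (-(u + r) * bFun r (omegaDiff N a b) u) * hz a -
      cFun r (omegaDiff N a b) u * hd a b
  · apply mul_left_cancel₀ hur
    rw [cFun_add hr h (norm_omegaDiff a b)]
    field_simp
    linear_combination (-bFun r (omegaDiff N a b) u) * hz a -
      (u + r) * cFun r (omegaDiff N a b) u * hd a b

/-- `c` is eliminated from two consecutive shift relations, after which the common factor `u + r +
1` cancels. -/
theorem bFun_second_order {z : ℂ} (hr : 0 < r.re) (h : Regular r u) (hz : ‖z‖ = 1) :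
    z * (u + 2 * r + 1) * bFun r z (u + 2 * r) -
      (u + r + z * (u + 2 * r)) * bFun r z (u + r) + (u + r - 1) * bFun r z u = 0 := by
  have hz0 : z ≠ 0 := norm_ne_zero_iff.mp (by rw [hz]; exact one_ne_zero)
  have hur : u + r + 1 ≠ 0 := fun e => (h 0).2.2 (by push_cast; linear_combination e)
  have b1 := bFun_add hr h hz
  have c1 := cFun_add hr h hz
  have b2 := bFun_add hr h.add hz
  rw [show u + r + r = u + 2 * r by ring] at b2
  have hzz := mul_inv_cancel₀ hz0
  apply mul_left_cancel₀ hur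
  linear_combination (u + r + 1) * z * b2 + (u + r + 1) * cFun r z (u + r) * hzz + c1 -
    (u + r) * b1

theorem cFun_second_order {z : ℂ} (hr : 0 < r.re) (h : Regular r u) (hz : ‖z‖ = 1) :
    (u + 2 * r + 1) * cFun r z (u + 2 * r) -
      (u + r + z⁻¹ * (u + 2 * r)) * cFun r z (u + r) + z⁻¹ * (u + r - 1) * cFun r z u = 0 := by
  have hur : u + r + 1 ≠ 0 := fun e => (h 0).2.2 (by push_cast; linear_combination e)
  have b1 := bFun_add hr h hz
  have c1 := cFun_add hr h hz
  have c2 := cFun_add hr h.add hz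
  rw [show u + r + r = u + 2 * r by ring] at c2
  apply mul_left_cancel₀ hur
  linear_combination (u + r + 1) * c2 + b1 - (u + r) * c1

lemma Generic.regular (h : Generic r u) : Regular r u := fun k => by
  obtain ⟨h1, h2, h3⟩ := h (-(k + 1))
  push_cast at h1 h2 h3
  exact ⟨fun e => h1 (by linear_combination e), fun e => h3 (by linear_combination e),
    fun e => h2 (by linear_combination e)⟩

/-- Regularity is needed at `u`, for the invertibility of `F(u)`, and at `-u - r`, for the shift
from there to `-u`. -/
lemma Generic.regular_neg (h : Generic r u) : Regular r (-u - r) := fun k => by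
  obtain ⟨h1, h2, h3⟩ := h k
  push_cast at h1 h2 h3
  exact ⟨fun e => h1 (by linear_combination -e), fun e => h2 (by linear_combination -e),
    fun e => h3 (by linear_combination -e)⟩

variable [NeZero N]

/-- The angle of `ω^{b-a}` in `[0, 2π)`. -/
def angle (a b : Fin N) : ℝ := 2 * Real.pi * (b - a : Fin N).val / N

lemma angle_mem (a b : Fin N) : angle a b ∈ Set.Icc 0 (2 * Real.pi) := by
  have hN : (0 : ℝ) < N := Nat.cast_pos.mpr (NeZero.pos N)
  have hlt : ((b - a : Fin N).val : ℝ) ≤ N := by exact_mod_cast (b - a).isLt.le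
  refine ⟨by unfold angle; positivity, ?_⟩
  rw [angle, div_le_iff₀ hN]
  gcongr

lemma omegaDiff_eq_exp (a b : Fin N) : omegaDiff N a b = exp (I * angle a b) := by
  have hN := NeZero.ne N
  have h1 : omega N ^ (b - a : Fin N).val = exp (I * angle a b) := by
    rw [omega, ← exp_nat_mul, angle]; push_cast; congr 1; ring
  rw [← h1, omegaDiff, zpow_sub₀ (omega_ne_zero N), zpow_natCast, zpow_natCast,
    div_eq_iff (pow_ne_zero _ (omega_ne_zero N)), ← pow_add, ← omega_pow_mod N hN (_ + a.val),
    ← Fin.val_add, sub_add_cancel]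

lemma omegaDiff_ne_one {a b : Fin N} (h : a ≠ b) : omegaDiff N a b ≠ 1 := by
  intro e
  have h1 : omega N ^ b.val = omega N ^ a.val := by
    rw [omegaDiff, zpow_sub₀ (omega_ne_zero N), zpow_natCast, zpow_natCast,
      div_eq_one_iff_eq (pow_ne_zero _ (omega_ne_zero N))] at e
    exact e
  exact h (Fin.ext ((omega_isPrimitiveRoot N (NeZero.ne N)).pow_inj b.isLt a.isLt h1)).symm

/-- The inverse is given by Cramer's rule on each block; the two rows share one determinant because
`twistDet` is symmetric under `z ↦ z⁻¹`. -/
theorem isUnit_det_twistF (hr : 0 < r.re) (h : Regular r u) : IsUnit (twistF N r u).det := by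
  refine Matrix.isUnit_det_of_right_inverse (B := exchangeMatrix (fun _ => 1)
    (fun a b => bFun r (omegaDiff N b a) u / twistDet r (omegaDiff N a b) u)
    (fun a b => -cFun r (omegaDiff N a b) u / twistDet r (omegaDiff N a b) u)) ?_
  have hsymm : ∀ a b : Fin N, twistDet r (omegaDiff N b a) u = twistDet r (omegaDiff N a b) u :=
    fun a b => by rw [twistDet, twistDet, omegaDiff_inv, omegaDiff_inv]; ring
  rw [twistF_eq, exchangeMatrix_mul, ← exchangeMatrix_one]
  refine exchangeMatrix_congr (fun a => by simp) (fun a b hab => ?_) (fun a b hab => ?_)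
  · have hD := twistDet_ne_zero hr h (norm_omegaDiff a b) (omegaDiff_ne_one hab)
    have hT : twistDet r (omegaDiff N a b) u =
        bFun r (omegaDiff N a b) u * bFun r (omegaDiff N b a) u -
          cFun r (omegaDiff N a b) u * cFun r (omegaDiff N b a) u := by
      rw [twistDet, omegaDiff_inv]
    rw [hsymm a b]
    generalize twistDet r (omegaDiff N a b) u = D at *
    field_simp
    linear_combination -hT
  · rw [hsymm a b]
    ring

lemma cotSum_first (hr0 : r ≠ 0) (hs : ∀ k : ℤ, u / r ≠ k) (a b : Fin N) (hab : a ≠ b) :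
    cotSum N (Real.pi * u / (N * r)) (b - a) =
      N * (exp (I * Real.pi * u / r) / sin (Real.pi * u / r)) *
        exp (-(2 * I * Real.pi * ((b - a : Fin N).val : ℂ) * u / (N * r))) := by
  have hN : (N : ℂ) ≠ 0 := Nat.cast_ne_zero.mpr (NeZero.ne N)
  have e : (N : ℂ) * (Real.pi * u / (N * r)) = Real.pi * u / r := by field_simp
  have hsin : sin (Real.pi * u / r) ≠ 0 := by
    rw [mul_div_assoc]; exact sin_pi_mul_ne_zero hs
  have hk : (b - a : Fin N).val ≠ 0 := fun e => hab (by
    have : b - a = 0 := Fin.ext (by simpa using e)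
    exact (sub_eq_zero.mp this).symm)
  rw [cotSum_of_val_ne_zero N (NeZero.ne N) (by rw [e]; exact hsin) hk, e]
  congr 2
  · congr 2; ring
  · ring

lemma cotSum_zero (hr0 : r ≠ 0) (hs : ∀ k : ℤ, u / r ≠ k) :
    cotSum N (Real.pi * u / (N * r)) 0 = N * cot (Real.pi * u / r) := by
  have hN : (N : ℂ) ≠ 0 := Nat.cast_ne_zero.mpr (NeZero.ne N)
  have e : (N : ℂ) * (Real.pi * u / (N * r)) = Real.pi * u / r := by field_simp
  have hsin : sin (Real.pi * u / r) ≠ 0 := by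
    rw [mul_div_assoc]; exact sin_pi_mul_ne_zero hs
  rw [cotSum_of_val_eq_zero N (NeZero.ne N) (by rw [e]; exact hsin) (Fin.val_zero N), e]

/-- The explicit form of `S`. -/
theorem Smat_eq_explicit (hr0 : r ≠ 0) (hs : ∀ k : ℤ, 1 / r ≠ k) (hx : ∀ k : ℤ, u / r ≠ k) :
    Smat N r u = exchangeMatrix
      (fun _ => N * (cot (Real.pi * u / r) + cot (Real.pi / r)))
      (fun a b => N * (exp (I * Real.pi / r) / sin (Real.pi / r)) *
        exp (-(2 * I * Real.pi * ((b - a : Fin N).val : ℂ) / (N * r))))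
      (fun a b => N * (exp (I * Real.pi * u / r) / sin (Real.pi * u / r)) *
        exp (-(2 * I * Real.pi * ((b - a : Fin N).val : ℂ) * u / (N * r)))) := by
  rw [Smat_eq hr0 hs hx]
  refine exchangeMatrix_congr (fun a => ?_) (fun a b hab => ?_) (fun a b hab => ?_)
  · have h1 := cotSum_zero (N := N) hr0 hs
    have h2 := cotSum_zero (N := N) hr0 hx
    rw [mul_one] at h1
    rw [h1, h2]; ring
  · have h1 := cotSum_first hr0 hs a b hab
    simpa only [mul_one] using h1
  · exact cotSum_first hr0 hx a b hab

/-- Stated without `F(u)⁻¹`, the claim splits into one scalar identity per entry: the sine addition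
formula on the diagonal, and off it the two connection formulas at `θ = angle a b`. -/
theorem flip21_twistF_mul_yangR (hr : 0 < r.re) (hr1 : ∀ k : ℤ, k * r ≠ 1) (h : Generic r u) :
    flip21 (twistF N r (-u)) * yangR N u =
      prefactor N r u • Smat N r u * twistF N r u := by
  have hr0 := ne_zero_of_re_pos hr
  have hs : ∀ k : ℤ, 1 / r ≠ k := fun k e => hr1 k (by rw [← e]; field_simp)
  have hx := fun k : ℤ => (h.ne_int hr0 k).1
  have hN : (N : ℂ) ≠ 0 := Nat.cast_ne_zero.mpr (NeZero.ne N)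
  have s1 : sin (Real.pi * u / r) ≠ 0 := by
    rw [mul_div_assoc]; exact sin_pi_mul_ne_zero hx
  have s2 : sin (Real.pi / r) ≠ 0 := by
    have := sin_pi_mul_ne_zero hs
    rwa [mul_one_div] at this
  have s3 : sin (Real.pi * (u + 1) / r) ≠ 0 := by
    rw [mul_div_assoc]; exact sin_pi_mul_ne_zero fun k => (h.ne_int hr0 k).2.1
  have hu1 : u + 1 ≠ 0 := by simpa using (h 0).2.1
  have hu2 : 1 - u ≠ 0 := fun e => (h 0).2.2 (by push_cast; linear_combination -e)
  rw [Smat_eq_explicit hr0 hs hx, twistF_eq, twistF_eq, flip21_exchangeMatrix, yangR_eq,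
    smul_exchangeMatrix, exchangeMatrix_mul, exchangeMatrix_mul]
  have hB : ∀ a b : Fin N, (1 - u) * bFun r (omegaDiff N b a) (-u) =
      -u * bFun r (omegaDiff N b a) (-u - r) +
        omegaDiff N a b * cFun r (omegaDiff N b a) (-u - r) := fun a b => by
    have := bFun_add hr h.regular_neg (norm_omegaDiff b a)
    rw [omegaDiff_inv, show -u - r + r = -u by ring] at this
    linear_combination this
  have hC : ∀ a b : Fin N, (1 - u) * cFun r (omegaDiff N b a) (-u) =
      bFun r (omegaDiff N b a) (-u - r) -
        u * (omegaDiff N a b * cFun r (omegaDiff N b a) (-u - r)) := fun a b => by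
    have := cFun_add hr h.regular_neg (norm_omegaDiff b a)
    rw [omegaDiff_inv, show -u - r + r = -u by ring] at this
    linear_combination this
  -- At the angle `2πn/N` the branch factors become exactly the phases in the entries of `S`; the
  -- shift by `π` supplies `e^{iπ/r}` and `e^{iπu/r}`.
  have E1 : ∀ a b : Fin N, exp (-(I * (1 / r) * (angle a b - Real.pi))) =
      exp (I * Real.pi / r) *
        exp (-(2 * I * Real.pi * ((b - a : Fin N).val : ℂ) / (N * r))) := fun a b => by
    rw [← exp_add, angle]; push_cast; congr 1; field_simp; ring
  have E2 : ∀ a b : Fin N, exp (-(I * (u / r) * (angle a b - Real.pi))) =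
      exp (I * Real.pi * u / r) *
        exp (-(2 * I * Real.pi * ((b - a : Fin N).val : ℂ) * u / (N * r))) := fun a b => by
    rw [← exp_add, angle]; push_cast; congr 1; field_simp; ring
  have kB : ∀ a b : Fin N, _ := fun a b => bFun_connection hr hr1 h (angle_mem a b)
  have kC : ∀ a b : Fin N, _ := fun a b => cFun_connection hr hr1 h (angle_mem a b)
  simp only [← omegaDiff_eq_exp, omegaDiff_inv, E1, E2] at kB kC
  refine exchangeMatrix_congr (fun a => ?_) (fun a b hab => ?_) (fun a b hab => ?_)
  · rw [prefactor, Complex.cot_eq_cos_div_sin, Complex.cot_eq_cos_div_sin]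
    have : sin (Real.pi * (u + 1) / r) = sin (Real.pi * u / r) * cos (Real.pi / r) +
        cos (Real.pi * u / r) * sin (Real.pi / r) := by
      rw [← Complex.sin_add]; congr 1; ring
    field_simp
    linear_combination this
  · have k := kB a b
    have b1 := hB a b
    have c1 := hC a b
    rw [prefactor]
    generalize exp (I * Real.pi / r) = P1 at *
    generalize exp (I * Real.pi * u / r) = P2 at *
    generalize exp (-(2 * I * Real.pi * ((b - a : Fin N).val : ℂ) / (N * r))) = Q1 at *
    generalize exp (-(2 * I * Real.pi * ((b - a : Fin N).val : ℂ) * u / (N * r))) = Q2 at *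
    -- Unitarity of `Y` in scalar form: multiplying by `Y(u)` undoes the shift from `-u - r` to
    -- `-u`. The factor `1 - u` cancelled here is nonzero by genericity.
    have e : bFun r (omegaDiff N b a) (-u) * (u / (u + 1)) +
        cFun r (omegaDiff N b a) (-u) * (1 / (u + 1)) = bFun r (omegaDiff N b a) (-u - r) := by
      field_simp
      apply mul_left_cancel₀ hu2
      linear_combination u * b1 + c1
    rw [e]
    generalize sin (Real.pi * u / r) = S1 at *
    generalize sin (Real.pi * (u + 1) / r) = S2 at *
    generalize sin (Real.pi / r) = S3 at *
    field_simp
    linear_combination k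
  · have k := kC a b
    have b1 := hB a b
    have c1 := hC a b
    rw [prefactor]
    generalize exp (I * Real.pi / r) = P1 at *
    generalize exp (I * Real.pi * u / r) = P2 at *
    generalize exp (-(2 * I * Real.pi * ((b - a : Fin N).val : ℂ) / (N * r))) = Q1 at *
    generalize exp (-(2 * I * Real.pi * ((b - a : Fin N).val : ℂ) * u / (N * r))) = Q2 at *
    have e : bFun r (omegaDiff N b a) (-u) * (1 / (u + 1)) +
        cFun r (omegaDiff N b a) (-u) * (u / (u + 1)) =
          omegaDiff N a b * cFun r (omegaDiff N b a) (-u - r) := by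
      field_simp
      apply mul_left_cancel₀ hu2
      linear_combination b1 + u * c1
    rw [e]
    generalize sin (Real.pi * u / r) = S1 at *
    generalize sin (Real.pi * (u + 1) / r) = S2 at *
    generalize sin (Real.pi / r) = S3 at *
    field_simp
    linear_combination k

theorem twistedR_eq (hr : 0 < r.re) (hr1 : ∀ k : ℤ, k * r ≠ 1) (h : Generic r u) :
    twistedR N r u = (rhoDY N u * prefactor N r u) • Smat N r u := by
  rw [twistedR, dyR, Matrix.mul_smul, flip21_twistF_mul_yangR hr hr1 h, ← Matrix.smul_mul,
    Matrix.mul_nonsing_inv_cancel_right _ _ (isUnit_det_twistF hr h.regular), smul_smul]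

lemma dyrR_eq (N : ℕ) (r u : ℂ) :
    dyrR N r u = (-(rhoDYr N r u * prefactor N r u)) • Smat N r u := by
  rw [dyrR, Smat, Rbar, gauge, gauge, Matrix.mul_smul, Matrix.smul_mul]

end

end

end DeformedYangian

theorem mainTheorem5 (N : ℕ) (hN : 2 ≤ N) (r : ℂ) (hr : 0 < r.re) :
    -- the twist solves the evaluated linear equation, and is invertible
    (∀ u : ℂ, DeformedYangian.Regular r u →
      DeformedYangian.twistF N r (u + r) =
          (DeformedYangian.phiOne N)⁻¹ * DeformedYangian.twistF N r u *
            DeformedYangian.phiOne N * DeformedYangian.yangR N (u + r) ∧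
        IsUnit (DeformedYangian.twistF N r u).det) ∧
    -- the scalar difference equations for its entries
    (∀ u : ℂ, DeformedYangian.Regular r u → ∀ a b : Fin N, a ≠ b →
      DeformedYangian.omegaDiff N a b * (u + 2 * r + 1) *
            DeformedYangian.bFun r (DeformedYangian.omegaDiff N a b) (u + 2 * r) -
          (u + r + DeformedYangian.omegaDiff N a b * (u + 2 * r)) *
            DeformedYangian.bFun r (DeformedYangian.omegaDiff N a b) (u + r) +
          (u + r - 1) * DeformedYangian.bFun r (DeformedYangian.omegaDiff N a b) u = 0 ∧
        (u + 2 * r + 1) *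
            DeformedYangian.cFun r (DeformedYangian.omegaDiff N a b) (u + 2 * r) -
          (u + r + DeformedYangian.omegaDiff N b a * (u + 2 * r)) *
            DeformedYangian.cFun r (DeformedYangian.omegaDiff N a b) (u + r) +
          DeformedYangian.omegaDiff N b a * (u + r - 1) *
            DeformedYangian.cFun r (DeformedYangian.omegaDiff N a b) u = 0) ∧
    -- the gauge matrix is invertible
    IsUnit (DeformedYangian.gaugeV N).det ∧
    -- the twisted matrix is the matrix of the deformed double Yangian
    ((∀ k : ℤ, k * r ≠ 1) → ∀ u : ℂ, DeformedYangian.Generic r u →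
      DeformedYangian.twistedR N r u =
          (DeformedYangian.rhoDY N u * DeformedYangian.prefactor N r u) •
            DeformedYangian.Smat N r u ∧
        DeformedYangian.dyrR N r u =
          (-(DeformedYangian.rhoDYr N r u * DeformedYangian.prefactor N r u)) •
            DeformedYangian.Smat N r u ∧
        (DeformedYangian.rhoDYr N r u ≠ 0 →
          DeformedYangian.twistedR N r u =
            (-(DeformedYangian.rhoDY N u / DeformedYangian.rhoDYr N r u)) •
              DeformedYangian.dyrR N r u) ∧
        -- the entries of `S`
        (∀ a : Fin N, DeformedYangian.Smat N r u (a, a) (a, a) =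
          N * (Complex.cot (Real.pi * u / r) + Complex.cot (Real.pi / r))) ∧
        (∀ a b : Fin N, a ≠ b →
          DeformedYangian.Smat N r u (a, b) (a, b) =
              N * (Complex.exp (Complex.I * Real.pi / r) / Complex.sin (Real.pi / r)) *
                Complex.exp (-(2 * Complex.I * Real.pi * ((b - a : Fin N).val : ℂ) / (N * r))) ∧
            DeformedYangian.Smat N r u (a, b) (b, a) =
              N * (Complex.exp (Complex.I * Real.pi * u / r) /
                  Complex.sin (Real.pi * u / r)) *
                Complex.exp
                  (-(2 * Complex.I * Real.pi * ((b - a : Fin N).val : ℂ) * u / (N * r)))) ∧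
        (∀ i j : Fin N × Fin N, j ≠ i → j ≠ i.swap →
          DeformedYangian.Smat N r u i j = 0)) := by
  have : NeZero N := ⟨by omega⟩
  refine ⟨fun u h => ⟨DeformedYangian.twistF_add hr h, DeformedYangian.isUnit_det_twistF hr h⟩,
    fun u h a b hab => ⟨DeformedYangian.bFun_second_order hr h (DeformedYangian.norm_omegaDiff a b),
      ?_⟩, DeformedYangian.isUnit_det_gaugeV, fun hr1 u h => ?_⟩
  · rw [← DeformedYangian.omegaDiff_inv a b]
    exact DeformedYangian.cFun_second_order hr h (DeformedYangian.norm_omegaDiff a b)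
  have hr0 := DeformedYangian.ne_zero_of_re_pos hr
  have hs : ∀ k : ℤ, 1 / r ≠ k := fun k e => hr1 k (by rw [← e]; field_simp)
  have hx := fun k : ℤ => (h.ne_int hr0 k).1
  have hS := DeformedYangian.Smat_eq_explicit (N := N) hr0 hs hx
  have h1 := DeformedYangian.twistedR_eq (N := N) hr hr1 h
  have h2 := DeformedYangian.dyrR_eq N r u
  refine ⟨h1, h2, fun hρ => ?_, fun a => ?_, fun a b hab => ⟨?_, ?_⟩, fun i j hij hij' => ?_⟩
  · rw [h1, h2, smul_smul]
    congr 1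
    field_simp
  · rw [hS]
    simp [DeformedYangian.exchangeMatrix]
  · rw [hS]
    simp [DeformedYangian.exchangeMatrix, hab]
  · rw [hS]
    simp [DeformedYangian.exchangeMatrix, hab, Ne.symm hab]
  · rw [hS]
    simp [DeformedYangian.exchangeMatrix, hij, hij']
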